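/- **Random instance.** For integers $n\ge K$ and $m$, an instance of NAE-$K$-SAT on Boolean variables $x_1,\dots,x_n$ has $m$ clauses, each made of $K$ literals (a variable or its negation) on distinct variables. An assignment $\sigma\in\{0,1\}^n$ satisfies the instance if every clause contains a literal with value $1$ and a literal with value $0$. For $d>0$, $\Phi(n,dn)$ is the random instance with $\lfloor dn\rfloor$ independent clauses, where the variables of each clause are drawn uniformly without replacement and each of them is negated independently with probability $1/2$. **Reduced instances.** When variables are set, their literals are deleted from the clauses. A clause none of whose variables has been set is unsigned. A clause is signed $+$ if all literals deleted from it had value $1$, and $-$ if all of them had value $0$. Clauses in which both values have been seen (satisfied), and clauses with no literal left that have seen only one value (violated), are removed. **Survey propagation (SP) with $r$ iterations** on a (possibly) reduced instance. For every clause $C$ and variable $x$ occurring in $C$ draw five independent uniform $[0,1]$ numbers $Q^0_{x,C,U},Q^0_{x,C,S},Q^0_{x,C,*},Q^0_{C,x,S},Q^0_{C,x,U}$, and normalize the first three, and the last two, to have sum $1$. For $t\ge 0$ put $$Q^{t+1}_{C,x,S}=\prod_{y\in C\setminus x}Q^t_{y,C,U},\qquad Q^{t+1}_{C,x,U}=\prod_{y\in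 C\setminus x}Q^t_{y,C,S},$$ except that $Q^{t+1}_{C,x,S}=0$ if $C$ is signed $+$ and $Q^{t+1}_{C,x,U}=0$ if $C$ is signed $-$. Let $\mathcal S_{x,C}$ (resp. $\mathcal U_{x,C}$) be the set of clauses $D\ne C$ in which $x$ occurs with the same (resp. the opposite) polarity as in $C$, and put $$R^{t+1}_{x,C,*}=\prod_{D\in\mathcal S_{x,C}\cup\mathcal U_{x,C}}(1-Q^t_{D,x,S}-Q^t_{D,x,U}),$$ $$R^{t+1}_{x,C,S}=\prod_{D\in\mathcal U_{x,C}}(1-Q^t_{D,x,S})\prod_{D\in\mathcal S_{x,C}}(1-Q^t_{D,x,U})-R^{t+1}_{x,C,*},$$ $$R^{t+1}_{x,C,U}=\prod_{D\in\mathcal U_{x,C}}(1-Q^t_{D,x,U})\prod_{D\in\mathcal S_{x,C}}(1-Q^t_{D,x,S})-R^{t+1}_{x,C,*}.$$ Then $Q^{t+1}_{x,C,S},Q^{t+1}_{x,C,U},Q^{t+1}_{x,C,*}$ are these three numbers divided by their sum. After $r$ iterations let $\mathcal S_x$ and $\mathcal U_x$ be the sets of clauses in which $x$ occurs without and with negation,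 respectively, and put $$W_x(*)=\prod_{D\in\mathcal S_x\cup\mathcal U_x}(1-Q^r_{D,x,S}-Q^r_{D,x,U}),$$ $$W_x(1)=\prod_{D\in\mathcal U_x}(1-Q^r_{D,x,S})\prod_{D\in\mathcal S_x}(1-Q^r_{D,x,U})-W_x(*),$$ $$W_x(0)=\prod_{D\in\mathcal S_x}(1-Q^r_{D,x,S})\prod_{D\in\mathcal U_x}(1-Q^r_{D,x,U})-W_x(*),$$ and divide the three numbers by their sum. (Whenever a sum to be divided by is $0$, the quotients are taken to be $0$.) **SP-guided decimation with $r$ iterations.** For $i=1,\dots,n$ in turn, run $r$ iterations of SP, with fresh independent initial values, on the current reduced instance, set $x_i=1$ if $W_{x_i}(1)>W_{x_i}(0)$ and $x_i=0$ otherwise, and reduce the instance accordingly. The algorithm solves the instance if the resulting assignment satisfies it. **Theorem.** There exists $K_0$ such that for every integer $K\ge K_0$, every real $d>2^{K-2}\ln 2$ and every integer $r>0$, $$\lim_{n\to\infty}\mathbb P\bigl(\text{SP-guided decimation with } r \text{ iterations solves } \Phi(n,dn)\bigr)=0 .$$ -/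

import Mathlib

open Filter Topology MeasureTheory

namespace NAESat

/-- The literal `(x, true)` is the variable `x`, the literal `(x, false)` is its negation. -/
abbrev Literal (n : ℕ) : Type := Fin n × Bool

/-- The truth value of a literal under an assignment. -/
def Literal.eval {n : ℕ} (σ : Fin n → Bool) (l : Literal n) : Bool :=
  if l.2 then σ l.1 else !(σ l.1)

/-- A clause on `K` distinct variables, together with the polarities of its `K` literals
(`true`: not negated, `false`: negated). -/
abbrev Clause (n K : ℕ) : Type := (Fin K ↪ Fin n) × (Fin K → Bool)

/-- The `j`-th literal of a clause. -/
def Clause.literal {n K : ℕ} (C : Clause n K) (j : Fin K) : Literal n := (C.1 j, C.2 j)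

/-- A (non-reduced) NAE-`K`-SAT instance on `n` variables with `m` clauses. -/
abbrev Formula (n K m : ℕ) : Type := Fin m → Clause n K

/-- Every clause has a literal with value `1` and a literal with value `0`. -/
def Formula.Satisfies {n K m : ℕ} (Φ : Formula n K m) (σ : Fin n → Bool) : Prop :=
  ∀ a, (∃ j, ((Φ a).literal j).eval σ = true) ∧ (∃ j, ((Φ a).literal j).eval σ = false)

/-- The decoration of a reduced clause: `neutral` if none of its variables has been set,
`plus` if all literals removed so far were set to `1` (so that a `0` is still needed), `minus` if
all literals removed so far were set to `0` (so that a `1` is still needed). -/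
inductive ClauseSign : Type
  | neutral
  | plus
  | minus
  deriving DecidableEq

/-- A reduced clause: the set of its remaining literals, and its sign. -/
structure ReducedClause (n : ℕ) : Type where
  lits : Finset (Literal n)
  sign : ClauseSign

/-- A reduced instance with clause names in `Fin m`; the value `none` means that the clause has
been removed. -/
abbrev ReducedFormula (n m : ℕ) : Type := Fin m → Option (ReducedClause n)

/-- A non-reduced instance, seen as a reduced instance all of whose clauses are neutral. -/
def Formula.toReduced {n K m : ℕ} (Φ : Formula n K m) : ReducedFormula n m := fun a =>
  some ⟨Finset.univ.image (Φ a).literal, ClauseSign.neutral⟩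

/-- The effect on a reduced clause of setting variable `x` to `b`. If `x` does not occur, nothing
changes. Otherwise the literal of `x` is deleted, its value (`1` if `(x, b)` is the literal that
occurs, `0` if it is `(x, !b)`) updates the sign, and the clause is removed when it has become
satisfied (both values have been seen) or violated (no literal is left, and only one value has been
seen). -/
def ReducedClause.assign {n : ℕ} (C : ReducedClause n) (x : Fin n) (b : Bool) :
    Option (ReducedClause n) :=
  let rest := C.lits.filter (fun l => l.1 ≠ x)
  if (x, b) ∈ C.lits then
    (if C.sign = ClauseSign.minus ∨ rest = ∅ then none else some ⟨rest, ClauseSign.plus⟩)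
  else if (x, !b) ∈ C.lits then
    (if C.sign = ClauseSign.plus ∨ rest = ∅ then none else some ⟨rest, ClauseSign.minus⟩)
  else some C

/-- The reduced instance obtained by setting variable `x` to `b`. -/
def ReducedFormula.assign {n m : ℕ} (Φ : ReducedFormula n m) (x : Fin n) (b : Bool) :
    ReducedFormula n m := fun a =>
  (Φ a).bind (fun C => C.assign x b)

/-- The set of remaining literals of clause `a` (empty for a removed clause). -/
def ReducedFormula.lits {n m : ℕ} (Φ : ReducedFormula n m) (a : Fin m) : Finset (Literal n) :=
  match Φ a with
  | none => ∅
  | some C => C.lits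

/-- The clauses in which `x` occurs without negation. -/
def ReducedFormula.posClauses {n m : ℕ} (Φ : ReducedFormula n m) (x : Fin n) : Finset (Fin m) :=
  Finset.univ.filter (fun a => (x, true) ∈ Φ.lits a)

/-- The clauses in which `x` occurs with negation. -/
def ReducedFormula.negClauses {n m : ℕ} (Φ : ReducedFormula n m) (x : Fin n) : Finset (Fin m) :=
  Finset.univ.filter (fun a => (x, false) ∈ Φ.lits a)

/-- The clauses other than `a` in which `x` occurs with the same polarity as in `a`. -/
def ReducedFormula.sameClauses {n m : ℕ} (Φ : ReducedFormula n m) (x : Fin n) (a : Fin m) :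
    Finset (Fin m) :=
  Finset.univ.filter (fun c => c ≠ a ∧ ∃ b : Bool, (x, b) ∈ Φ.lits a ∧ (x, b) ∈ Φ.lits c)

/-- The clauses other than `a` in which `x` occurs with the polarity opposite to that in `a`. -/
def ReducedFormula.oppClauses {n m : ℕ} (Φ : ReducedFormula n m) (x : Fin n) (a : Fin m) :
    Finset (Fin m) :=
  Finset.univ.filter (fun c => c ≠ a ∧ ∃ b : Bool, (x, b) ∈ Φ.lits a ∧ (x, !b) ∈ Φ.lits c)

/-- The survey propagation messages: `varU x a`, `varS x a`, `varStar x a` are the messages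
`Q_{x,a,U}`, `Q_{x,a,S}`, `Q_{x,a,*}` from variable `x` to clause `a`, and `clS a x`, `clU a x` are
the messages `Q_{a,x,S}`, `Q_{a,x,U}` from clause `a` to variable `x`. Only pairs such that `x`
occurs in `a` matter; the other entries are never used. -/
structure Messages (n m : ℕ) : Type where
  varU : Fin n → Fin m → ℝ
  varS : Fin n → Fin m → ℝ
  varStar : Fin n → Fin m → ℝ
  clS : Fin m → Fin n → ℝ
  clU : Fin m → Fin n → ℝ

/-- Names of the five numbers that are attached to a variable/clause pair. -/
inductive MessageKind : Type
  | varU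
  | varS
  | varStar
  | clS
  | clU
  deriving DecidableEq

instance : Fintype MessageKind where
  elems := {.varU, .varS, .varStar, .clS, .clU}
  complete := fun k => by cases k <;> decide

/-- The unnormalized initial messages. Its `volume` is the product of the uniform distributions on
`[0,1]`: the numbers are independent and uniform. -/
abbrev Seeds (n m : ℕ) : Type := Fin n → Fin m → MessageKind → unitInterval

/-- The messages at time `0`: normalized seeds. -/
noncomputable def initialMessages {n m : ℕ} (q : Seeds n m) : Messages n m where
  varU x a := (q x a .varU : ℝ) / (q x a .varU + q x a .varS + q x a .varStar)
  varS x a := (q x a .varS : ℝ) / (q x a .varU + q x a .varS + q x a .varStar)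
  varStar x a := (q x a .varStar : ℝ) / (q x a .varU + q x a .varS + q x a .varStar)
  clS a x := (q x a .clS : ℝ) / (q x a .clS + q x a .clU)
  clU a x := (q x a .clU : ℝ) / (q x a .clS + q x a .clU)

/-- New message `Q_{a,x,S}`: all other variables of `a` are forced to violate `a`; it vanishes for
a clause signed `+`. -/
noncomputable def nextClS {n m : ℕ} (Φ : ReducedFormula n m) (Q : Messages n m)
    (a : Fin m) (x : Fin n) : ℝ :=
  match Φ a with
  | none => 0
  | some C => if C.sign = ClauseSign.plus then 0
      else ∏ l ∈ C.lits.filter (fun l => l.1 ≠ x), Q.varU l.1 a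

/-- New message `Q_{a,x,U}`: all other variables of `a` are forced to satisfy `a`; it vanishes for
a clause signed `-`. -/
noncomputable def nextClU {n m : ℕ} (Φ : ReducedFormula n m) (Q : Messages n m)
    (a : Fin m) (x : Fin n) : ℝ :=
  match Φ a with
  | none => 0
  | some C => if C.sign = ClauseSign.minus then 0
      else ∏ l ∈ C.lits.filter (fun l => l.1 ≠ x), Q.varS l.1 a

/-- `R_{x,a,*}`: no clause other than `a` forces `x`. -/
noncomputable def nextRStar {n m : ℕ} (Φ : ReducedFormula n m) (Q : Messages n m)
    (x : Fin n) (a : Fin m) : ℝ :=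
  (∏ c ∈ Φ.oppClauses x a, (1 - Q.clS c x - Q.clU c x)) *
    ∏ c ∈ Φ.sameClauses x a, (1 - Q.clS c x - Q.clU c x)

/-- `R_{x,a,S}`: the other clauses force `x` to satisfy `a`, and none forces the opposite. -/
noncomputable def nextRS {n m : ℕ} (Φ : ReducedFormula n m) (Q : Messages n m)
    (x : Fin n) (a : Fin m) : ℝ :=
  (∏ c ∈ Φ.oppClauses x a, (1 - Q.clS c x)) * (∏ c ∈ Φ.sameClauses x a, (1 - Q.clU c x))
    - nextRStar Φ Q x a

/-- `R_{x,a,U}`: the other clauses force `x` to violate `a`, and none forces the opposite. -/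
noncomputable def nextRU {n m : ℕ} (Φ : ReducedFormula n m) (Q : Messages n m)
    (x : Fin n) (a : Fin m) : ℝ :=
  (∏ c ∈ Φ.oppClauses x a, (1 - Q.clU c x)) * (∏ c ∈ Φ.sameClauses x a, (1 - Q.clS c x))
    - nextRStar Φ Q x a

/-- One (parallel) survey propagation iteration: all messages at time `t + 1` from those at time
`t`. -/
noncomputable def nextMessages {n m : ℕ} (Φ : ReducedFormula n m) (Q : Messages n m) :
    Messages n m where
  varU x a := nextRU Φ Q x a / (nextRS Φ Q x a + nextRU Φ Q x a + nextRStar Φ Q x a)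
  varS x a := nextRS Φ Q x a / (nextRS Φ Q x a + nextRU Φ Q x a + nextRStar Φ Q x a)
  varStar x a := nextRStar Φ Q x a / (nextRS Φ Q x a + nextRU Φ Q x a + nextRStar Φ Q x a)
  clS := nextClS Φ Q
  clU := nextClU Φ Q

/-- The messages after `r` iterations, for given seeds. -/
noncomputable def messagesAt {n m : ℕ} (Φ : ReducedFormula n m) (q : Seeds n m) :
    ℕ → Messages n m
  | 0 => initialMessages q
  | t + 1 => nextMessages Φ (messagesAt Φ q t)

/-- `W_x(*)` before normalization. -/
noncomputable def rawWStar {n m : ℕ} (Φ : ReducedFormula n m) (Q : Messages n m)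
    (x : Fin n) : ℝ :=
  (∏ c ∈ Φ.posClauses x, (1 - Q.clS c x - Q.clU c x)) *
    ∏ c ∈ Φ.negClauses x, (1 - Q.clS c x - Q.clU c x)

/-- `W_x(1)` before normalization. -/
noncomputable def rawWOne {n m : ℕ} (Φ : ReducedFormula n m) (Q : Messages n m)
    (x : Fin n) : ℝ :=
  (∏ c ∈ Φ.negClauses x, (1 - Q.clS c x)) * (∏ c ∈ Φ.posClauses x, (1 - Q.clU c x))
    - rawWStar Φ Q x

/-- `W_x(0)` before normalization. -/
noncomputable def rawWZero {n m : ℕ} (Φ : ReducedFormula n m) (Q : Messages n m)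
    (x : Fin n) : ℝ :=
  (∏ c ∈ Φ.posClauses x, (1 - Q.clS c x)) * (∏ c ∈ Φ.negClauses x, (1 - Q.clU c x))
    - rawWStar Φ Q x

/-- `W_x(1)`. -/
noncomputable def WOne {n m : ℕ} (Φ : ReducedFormula n m) (Q : Messages n m) (x : Fin n) : ℝ :=
  rawWOne Φ Q x / (rawWOne Φ Q x + rawWZero Φ Q x + rawWStar Φ Q x)

/-- `W_x(0)`. -/
noncomputable def WZero {n m : ℕ} (Φ : ReducedFormula n m) (Q : Messages n m) (x : Fin n) : ℝ :=
  rawWZero Φ Q x / (rawWOne Φ Q x + rawWZero Φ Q x + rawWStar Φ Q x)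

open Classical in
/-- The value given to `x` after `r` iterations on the reduced instance `Φ`: it is `1` if
`W_x(1) > W_x(0)`, and `0` otherwise. -/
noncomputable def spDecision {n m : ℕ} (r : ℕ) (Φ : ReducedFormula n m) (q : Seeds n m)
    (x : Fin n) : Bool :=
  decide (WZero Φ (messagesAt Φ q r) x < WOne Φ (messagesAt Φ q r) x)

/-- The reduced instance after the first `i` decimation steps; step `i` sets the variable `i` using
the seeds `ω i`. -/
noncomputable def decimatedFormula {n K m : ℕ} (r : ℕ) (Φ : Formula n K m)
    (ω : Fin n → Seeds n m) : ℕ → ReducedFormula n m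
  | 0 => Φ.toReduced
  | i + 1 =>
    if h : i < n then
      (decimatedFormula r Φ ω i).assign ⟨i, h⟩
        (spDecision r (decimatedFormula r Φ ω i) (ω ⟨i, h⟩) ⟨i, h⟩)
    else decimatedFormula r Φ ω i

/-- The assignment produced by SP-guided decimation with `r` iterations per step. -/
noncomputable def spDecimation {n K m : ℕ} (r : ℕ) (Φ : Formula n K m)
    (ω : Fin n → Seeds n m) : Fin n → Bool := fun i =>
  spDecision r (decimatedFormula r Φ ω i) (ω i) i

/-- The probability that SP-guided decimation with `r` iterations per step solves the random
instance with `m` clauses on `n` variables. The instance is uniform on the finite set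
`Formula n K m`, that is, clauses are independent, the variables of each clause are drawn uniformly
without replacement and are negated by independent fair coins; the seeds of all decimation steps are
independent of it, of each other, and uniform on `[0,1]`. -/
noncomputable def spSuccessProb (K n m r : ℕ) : ℝ :=
  (∑ Φ : Formula n K m,
      (volume : Measure (Fin n → Seeds n m)).real {ω | Φ.Satisfies (spDecimation r Φ ω)})
    / (Fintype.card (Formula n K m) : ℝ)

end NAESat

/-! The obstruction is a three-replica overlap gap, combined with the locality of decimation. The
seeds are fixed once and for all; every bound is uniform in them and is integrated over them only at
the end.

Overlap gap. Put u = 2/2^K, the probability that an assignment violates a random clause. At density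
2^(K-2) ln 2 two independent satisfaction events cost 2^(-n), which only cancels the choice of one
assignment; three cost about 2^(-3n/2). There are at most 2.283^n triples in which two assignments
lie within n/100 of the third. If moreover all distances are at least n/200, double violations of a
clause are rare for large K, so even a clause shared by all three formulas costs a factor
exp(-5u/2). Since 2.283 < 2^(5/4), no such triple of solutions is expected, whatever initial segment
of clauses the three formulas share (`expect_triple_indicator_le`, `expect_three_satisfied_le`,
`card_triples_le`).

Stable algorithms meet the gap. Let `B` map formulas to assignments with total squared sensitivity
O(n). For two formulas that share their first i clauses, the mean output distance changes by O(√n)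
when i grows by one and vanishes when all clauses are shared; the distance itself concentrates by
Efron-Stein. Hence either independent runs are already close, or some i puts the mean distance
inside the forbidden window. By Jensen, three runs with this i all succeed with probability at least
the cube of the success probability. So a map close to `B` on average rarely succeeds
(`success_pow_three_le`, `success_pow_three_le_of_approx`).

Decimation is nearly stable. The decision at a variable depends directly only on the clauses within
distance 2r+1 and on earlier decisions within distance 2r+2. Influence from far away therefore needs
a long chain of decreasing variable indices. Along such a chain a tree in the factor graph can be
grown with L+1 marked variables in forced order. The expected number of trees is exponential in L
times n, while the order gains 1/(L+1)!, so for large L all but a small fraction of the decisions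
are functions of a bounded ball (`exists_grown_of_escape`, `expect_escapes_le`). Decimation
restricted to these balls has sensitivity O(n), because the expected sum of squared ball sizes is
O(n) (`exists_local_approx`). -/

open Finset
open scoped BigOperators

/-! ### Moment inequalities for finite averages -/

section Averages

theorem expect_sq_sub_expect {ι : Type*} [Fintype ι] [Nonempty ι] (f : ι → ℝ) :
    𝔼 x, (f x - 𝔼 y, f y) ^ 2 = 𝔼 x, f x ^ 2 - (𝔼 x, f x) ^ 2 := by
  set c := 𝔼 y, f y with hc
  have : ∀ x, (f x - c) ^ 2 = f x ^ 2 - 2 * c * f x + c ^ 2 := fun x => by ring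
  simp_rw [this]
  rw [expect_add_distrib, expect_sub_distrib, ← mul_expect, Fintype.expect_const, ← hc]
  ring

theorem sq_expect_le_expect_sq {ι : Type*} [Fintype ι] [Nonempty ι] (f : ι → ℝ) :
    (𝔼 x, f x) ^ 2 ≤ 𝔼 x, f x ^ 2 := by
  have h : 0 ≤ 𝔼 x, (f x - 𝔼 y, f y) ^ 2 := expect_nonneg fun x _ => sq_nonneg _
  rw [expect_sq_sub_expect] at h
  linarith

/-- The right side is exactly twice the variance; the lost factor does not matter here. -/
theorem expect_sq_sub_sq_expect_le {ι : Type*} [Fintype ι] [Nonempty ι] (f : ι → ℝ) :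
    𝔼 x, f x ^ 2 - (𝔼 x, f x) ^ 2 ≤ 𝔼 x, 𝔼 y, (f x - f y) ^ 2 := by
  have : ∀ x y, (f x - f y) ^ 2 = f x ^ 2 - 2 * f x * f y + f y ^ 2 := fun x y => by ring
  simp_rw [this, expect_add_distrib, expect_sub_distrib, ← mul_expect, Fintype.expect_const,
    ← expect_mul, ← mul_expect]
  have := sq_expect_le_expect_sq f
  nlinarith

theorem pow_three_expect_le {ι : Type*} [Fintype ι] [Nonempty ι] (f : ι → ℝ)
    (hf : ∀ x, 0 ≤ f x) : (𝔼 x, f x) ^ 3 ≤ 𝔼 x, f x ^ 3 := by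
  have h := Real.pow_arith_mean_le_arith_mean_pow (univ : Finset ι)
    (fun _ => ((Fintype.card ι : ℝ))⁻¹) f (fun _ _ => by positivity) (by
      rw [sum_const, card_univ, nsmul_eq_mul, mul_inv_cancel₀]
      exact_mod_cast Fintype.card_ne_zero) (fun x _ => hf x) 3
  rw [← mul_sum, ← mul_sum] at h
  rw [Fintype.expect_eq_sum_div_card, Fintype.expect_eq_sum_div_card]
  rw [div_eq_inv_mul, div_eq_inv_mul]
  exact h

theorem expect_fin_cons {α : Type*} [Fintype α] {m : ℕ} (f : (Fin (m + 1) → α) → ℝ) :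
    𝔼 x, f x = 𝔼 a, 𝔼 x, f (Fin.cons a x) := by
  rw [← expect_product']
  refine (Fintype.expect_equiv (Fin.consEquiv (fun _ => α)) _ _ fun i => ?_).symm
  simp [Fin.consEquiv]

/-- The Efron-Stein inequality on a finite product with the uniform distribution. -/
theorem efron_stein {α : Type*} [Fintype α] [Nonempty α] (m : ℕ) (F : (Fin m → α) → ℝ) :
    𝔼 x, F x ^ 2 - (𝔼 x, F x) ^ 2
      ≤ ∑ c, 𝔼 x, 𝔼 a, (F x - F (Function.update x c a)) ^ 2 := by
  induction m with
  | zero =>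
    simp [Fintype.expect_eq_sum_div_card]
  | succ m ih =>
    rw [Fin.sum_univ_succ]
    simp only [expect_fin_cons, Fin.update_cons_zero, ← Fin.cons_update]
    set G : (Fin m → α) → ℝ := fun x => 𝔼 a, F (Fin.cons a x) with hG
    have h1 : 𝔼 a, 𝔼 x, F (Fin.cons a x) = 𝔼 x, G x := expect_comm _ _ _
    -- Var F = (E F² - E G²) + Var G. The first summand is the mean conditional variance given the
    -- tail, bounded by resampling the first coordinate; the second is handled by induction.
    have h2 : 𝔼 a, 𝔼 x, F (Fin.cons a x) ^ 2 - 𝔼 x, G x ^ 2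
        ≤ 𝔼 a, 𝔼 x, 𝔼 b, (F (Fin.cons a x) - F (Fin.cons b x)) ^ 2 := by
      rw [expect_comm, expect_comm (s := univ) (t := univ)
        (f := fun a x => 𝔼 b, (F (Fin.cons a x) - F (Fin.cons b x)) ^ 2), ← expect_sub_distrib]
      exact expect_le_expect fun x _ => expect_sq_sub_sq_expect_le _
    -- Jensen moves the average over the first coordinate, hidden in `G`, out of the square.
    have h3 : ∀ c : Fin m, 𝔼 x, 𝔼 b, (G x - G (Function.update x c b)) ^ 2
        ≤ 𝔼 a, 𝔼 x, 𝔼 b, (F (Fin.cons a x)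
          - F (Fin.cons a (Function.update x c b))) ^ 2 := by
      intro c
      rw [expect_comm (s := univ) (t := univ) (f := fun a x => 𝔼 b, (F (Fin.cons a x)
          - F (Fin.cons a (Function.update x c b))) ^ 2)]
      refine expect_le_expect fun x _ => ?_
      rw [expect_comm (s := univ) (t := univ) (f := fun a b => (F (Fin.cons a x)
          - F (Fin.cons a (Function.update x c b))) ^ 2)]
      refine expect_le_expect fun b _ => ?_
      simp only [hG, ← expect_sub_distrib]
      exact sq_expect_le_expect_sq _
    have h4 := ih G
    have h5 := sum_le_sum fun c (_ : c ∈ univ) => h3 c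
    rw [h1]
    linarith

open Classical in
/-- Chebyshev's inequality for averages. -/
theorem expect_indicator_le_div_sq {ι : Type*} [Fintype ι] [Nonempty ι] (f : ι → ℝ) {t : ℝ}
    (ht : 0 < t) : 𝔼 x, (if t ≤ |f x - 𝔼 y, f y| then (1 : ℝ) else 0)
      ≤ (𝔼 x, f x ^ 2 - (𝔼 x, f x) ^ 2) / t ^ 2 := by
  rw [← expect_sq_sub_expect, expect_div]
  refine expect_le_expect fun x _ => ?_
  split_ifs with h
  · rw [le_div_iff₀ (by positivity), one_mul, ← sq_abs (f x - _)]
    gcongr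
  · positivity

open Classical in
/-- Markov's inequality for averages. -/
theorem expect_indicator_le_div {ι : Type*} [Fintype ι] (f : ι → ℝ) (hf : ∀ x, 0 ≤ f x)
    {t : ℝ} (ht : 0 < t) : 𝔼 x, (if t ≤ f x then (1 : ℝ) else 0) ≤ (𝔼 x, f x) / t := by
  rw [expect_div]
  refine expect_le_expect fun x _ => ?_
  split_ifs with h
  · rwa [le_div_iff₀ ht, one_mul]
  · exact div_nonneg (hf x) ht.le

end Averages

/-! ### Pairs of inputs with a common initial segment -/

section Interpolation

variable {α : Type*} {m n : ℕ}

/-- The sequence that agrees with `Z` before position `i` and with `X` from position `i` on. -/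
def mix (i : ℕ) (Z X : Fin m → α) : Fin m → α := fun c => if (c : ℕ) < i then Z c else X c

theorem mix_mix_left (i : ℕ) (Z X : Fin m → α) : mix i (mix i Z X) (mix i X Z) = Z := by
  funext c; simp only [mix]; split_ifs <;> rfl

/-- Exchanging the tails of two sequences. -/
def mixEquiv (i : ℕ) : ((Fin m → α) × (Fin m → α)) ≃ ((Fin m → α) × (Fin m → α)) where
  toFun p := (mix i p.1 p.2, mix i p.2 p.1)
  invFun p := (mix i p.1 p.2, mix i p.2 p.1)
  left_inv p := by simp [mix_mix_left]
  right_inv p := by simp [mix_mix_left]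

theorem mix_update (i : ℕ) (Z X : Fin m → α) (c : Fin m) (a b : α) :
    mix i (Function.update Z c a) (Function.update X c b)
      = Function.update (mix i Z X) c (if (c : ℕ) < i then a else b) := by
  funext e
  by_cases h : e = c
  · subst h; simp [mix]
  · simp [mix, h]

theorem mix_succ (i : Fin m) (Z X : Fin m → α) :
    mix (i + 1) Z X = Function.update (mix i Z X) i (Z i) := by
  funext e
  by_cases h : e = i
  · subst h; simp [mix]
  · have h' : (e : ℕ) ≠ i := fun h' => h (Fin.ext h')
    have : (e : ℕ) < i + 1 ↔ (e : ℕ) < i := by omega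
    simp [mix, h, this]

theorem mix_last (Z X : Fin m → α) : mix m Z X = Z := by
  funext e; simp [mix]

theorem abs_hammingDist_sub_le {x y x' y' : Fin n → Bool} :
    |(hammingDist x y : ℝ) - hammingDist x' y'| ≤ hammingDist x x' + hammingDist y y' := by
  have h1 : (hammingDist x y : ℝ) ≤ hammingDist x x' + hammingDist x' y' + hammingDist y y' := by
    have := hammingDist_triangle x x' y
    have h := hammingDist_triangle x' y' y
    rw [hammingDist_comm y' y] at h
    exact_mod_cast (by omega : hammingDist x y ≤ hammingDist x x' + hammingDist x' y'
      + hammingDist y y')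
  have h2 : (hammingDist x' y' : ℝ) ≤ hammingDist x x' + hammingDist x y + hammingDist y y' := by
    have := hammingDist_triangle x' x y'
    have h := hammingDist_triangle x y y'
    rw [hammingDist_comm x' x] at this
    exact_mod_cast (by omega : hammingDist x' y' ≤ hammingDist x x' + hammingDist x y
      + hammingDist y y')
  rw [abs_le]
  constructor <;> linarith

variable [Fintype α]

/-- Exchanging tails is an involution on pairs of sequences, so it preserves the uniform
distribution. In particular, each mixed sequence is again uniform. -/
theorem expect_expect_mix (i : ℕ) (f : (Fin m → α) → (Fin m → α) → ℝ) :
    𝔼 Z, 𝔼 X, f (mix i Z X) (mix i X Z) = 𝔼 Z, 𝔼 X, f Z X := by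
  rw [← expect_product', ← expect_product']
  exact Fintype.expect_equiv (mixEquiv i) _ _ fun p => rfl

/-- Several independent sequences are read as one sequence of tuples, so that product-space results
such as Efron-Stein apply to them jointly. -/
theorem expect_arrow_prod {β : Type*} [Fintype β] (f : (Fin m → α) → (Fin m → β) → ℝ) :
    𝔼 Z, 𝔼 X, f Z X
      = 𝔼 x : Fin m → α × β, f (fun c => (x c).1) (fun c => (x c).2) := by
  rw [← expect_product']
  exact (Fintype.expect_equiv (Equiv.arrowProdEquivProdArrow (Fin m) (fun _ => α) (fun _ => β))
    _ _ fun p => rfl).symm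

/-- The total squared sensitivity of a map to the resampling of single coordinates. -/
noncomputable def sensitivity (B : (Fin m → α) → (Fin n → Bool)) : ℝ :=
  ∑ c, 𝔼 Φ, 𝔼 a, (hammingDist (B Φ) (B (Function.update Φ c a)) : ℝ) ^ 2

/-- The mean distance of the outputs on two inputs that share their first `i` coordinates. -/
noncomputable def meanDist (B : (Fin m → α) → (Fin n → Bool)) (i : ℕ) : ℝ :=
  𝔼 Z, 𝔼 X, 𝔼 Y, (hammingDist (B (mix i Z X)) (B (mix i Z Y)) : ℝ)

theorem meanDist_last (B : (Fin m → α) → (Fin n → Bool)) : meanDist B m = 0 := by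
  simp [meanDist, mix_last]

variable [Nonempty α]

theorem expect_mix (i : ℕ) (f : (Fin m → α) → ℝ) : 𝔼 Z, 𝔼 X, f (mix i Z X) = 𝔼 Z, f Z := by
  rw [expect_expect_mix i fun Z _ => f Z]
  simp

theorem expect_eval (c : Fin m) (f : α → ℝ) : 𝔼 X : Fin m → α, f (X c) = 𝔼 a, f a := by
  have : 𝔼 p : α × ({j // j ≠ c} → α), f p.1 = 𝔼 a, f a := by
    rw [← univ_product_univ, expect_product]
    simp
  rw [← this]
  exact Fintype.expect_equiv (Equiv.funSplitAt c α) _ _ fun X => by simp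

theorem expect_prod_eval {β : Type*} [Fintype β] [Nonempty β] (g : Fin m → β → ℝ) :
    𝔼 x : Fin m → β, ∏ c, g c (x c) = ∏ c, 𝔼 b, g c b := by
  simp_rw [Fintype.expect_eq_sum_div_card]
  rw [prod_div_distrib, prod_univ_sum, Fintype.piFinset_univ]
  simp

theorem expect_hammingDist_update_le (B : (Fin m → α) → (Fin n → Bool)) (c : Fin m) :
    𝔼 Φ, 𝔼 a, (hammingDist (B Φ) (B (Function.update Φ c a)) : ℝ) ≤ √(sensitivity B) := by
  apply Real.le_sqrt_of_sq_le
  calc (𝔼 Φ, 𝔼 a, (hammingDist (B Φ) (B (Function.update Φ c a)) : ℝ)) ^ 2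
      ≤ 𝔼 Φ, (𝔼 a, (hammingDist (B Φ) (B (Function.update Φ c a)) : ℝ)) ^ 2 :=
        sq_expect_le_expect_sq _
    _ ≤ 𝔼 Φ, 𝔼 a, (hammingDist (B Φ) (B (Function.update Φ c a)) : ℝ) ^ 2 :=
        expect_le_expect fun _ _ => sq_expect_le_expect_sq _
    _ ≤ sensitivity B :=
        single_le_sum (f := fun c => 𝔼 Φ, 𝔼 a,
          (hammingDist (B Φ) (B (Function.update Φ c a)) : ℝ) ^ 2)
          (fun _ _ => expect_nonneg fun _ _ => expect_nonneg fun _ _ => by positivity)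
          (mem_univ c)

/-- Position `i` of `mix i Z X` still comes from `X`, so `Z i` is a fresh independent sample. -/
theorem expect_mix_update (i : Fin m) (g : (Fin m → α) → α → ℝ) :
    𝔼 Z, 𝔼 X, g (mix i Z X) (Z i) = 𝔼 Φ, 𝔼 a, g Φ a := by
  have h : ∀ Z X : Fin m → α, g (mix i Z X) (Z i) = g (mix i Z X) (mix i X Z i) := by
    intro Z X; simp [mix]
  simp_rw [h]
  rw [expect_expect_mix i fun Z X => g Z (X i)]
  exact expect_congr rfl fun Z _ => expect_eval i (g Z)

/-- Passing from `i` to `i + 1` overwrites coordinate `i` of both inputs by `Z i`. Each overwriting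
is a resampling, which moves the output by at most the square root of the sensitivity on average. -/
theorem abs_meanDist_sub_le (B : (Fin m → α) → (Fin n → Bool)) (i : Fin m) :
    |meanDist B i - meanDist B (i + 1)| ≤ 2 * √(sensitivity B) := by
  have key : ∀ Z X : Fin m → α, mix (i + 1) Z X = Function.update (mix i Z X) i (Z i) :=
    mix_succ i
  let h : (Fin m → α) → α → ℝ := fun Φ a => hammingDist (B Φ) (B (Function.update Φ i a))
  have h0 : 𝔼 Z, 𝔼 X, h (mix i Z X) (Z i) ≤ √(sensitivity B) := by
    rw [expect_mix_update i h]
    exact expect_hammingDist_update_le B i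
  calc |meanDist B i - meanDist B (i + 1)|
      ≤ 𝔼 Z, 𝔼 X, 𝔼 Y, |(hammingDist (B (mix i Z X)) (B (mix i Z Y)) : ℝ)
          - hammingDist (B (mix (i + 1) Z X)) (B (mix (i + 1) Z Y))| := by
        unfold meanDist
        simp only [← expect_sub_distrib]
        refine (abs_expect_le _ _).trans (expect_le_expect fun Z _ => ?_)
        refine (abs_expect_le _ _).trans (expect_le_expect fun X _ => ?_)
        exact abs_expect_le _ _
    _ ≤ 𝔼 Z, 𝔼 X, 𝔼 Y, (h (mix i Z X) (Z i) + h (mix i Z Y) (Z i)) := by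
        refine expect_le_expect fun Z _ => expect_le_expect fun X _ =>
          expect_le_expect fun Y _ => ?_
        rw [key, key]
        exact abs_hammingDist_sub_le
    _ = 𝔼 Z, 𝔼 X, h (mix i Z X) (Z i) + 𝔼 Z, 𝔼 X, h (mix i Z X) (Z i) := by
        simp only [expect_add_distrib, Fintype.expect_const]
    _ ≤ 2 * √(sensitivity B) := by linarith

/-- Efron-Stein on the sequence of triples (Z, X, Y): resampling one triple resamples a single
coordinate in each of the two inputs. The constant is 2 + 2, from (a + b)² ≤ 2a² + 2b². -/
theorem variance_dist_le (B : (Fin m → α) → (Fin n → Bool)) (i : ℕ) :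
    𝔼 Z, 𝔼 X, 𝔼 Y, (hammingDist (B (mix i Z X)) (B (mix i Z Y)) : ℝ) ^ 2 - meanDist B i ^ 2
      ≤ 4 * sensitivity B := by
  unfold meanDist
  simp only [expect_arrow_prod]
  refine (efron_stein m _).trans ?_
  rw [sensitivity, mul_sum]
  refine sum_le_sum fun c _ => ?_
  let h : (Fin m → α) → α → ℝ := fun Φ a => (hammingDist (B Φ) (B (Function.update Φ c a)) : ℝ) ^ 2
  have hu : ∀ {β γ : Type _} (x : Fin m → β) (b : β) (p : β → γ),
      (fun e => p (Function.update x c b e)) = Function.update (fun e => p (x e)) c (p b) :=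
    fun x b p => Function.comp_update p x c b
  have hX : ∀ (Z X : Fin m → α) , 𝔼 a : α × α × α,
      h (mix i Z X) (if (c : ℕ) < i then a.1 else a.2.1) = 𝔼 a, h (mix i Z X) a := by
    intro Z X
    split_ifs
    · simp only [← univ_product_univ, expect_product, Fintype.expect_const]
    · simp only [← univ_product_univ, expect_product, Fintype.expect_const]
  have hY : ∀ (Z X : Fin m → α) , 𝔼 a : α × α × α,
      h (mix i Z X) (if (c : ℕ) < i then a.1 else a.2.2) = 𝔼 a, h (mix i Z X) a := by
    intro Z X
    split_ifs
    · simp only [← univ_product_univ, expect_product, Fintype.expect_const]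
    · simp only [← univ_product_univ, expect_product, Fintype.expect_const]
  calc _ ≤ 𝔼 x : Fin m → α × α × α, 𝔼 a : α × α × α,
        (2 * h (mix i (fun c => (x c).1) (fun c => (x c).2.1)) (if (c : ℕ) < i then a.1 else a.2.1)
        + 2 * h (mix i (fun c => (x c).1) (fun c => (x c).2.2))
          (if (c : ℕ) < i then a.1 else a.2.2)) := by
        refine expect_le_expect fun x _ => expect_le_expect fun a _ => ?_
        have e1 := hu x a Prod.fst
        have e2 := hu x a (fun b : α × α × α => b.2.1)
        have e3 := hu x a (fun b : α × α × α => b.2.2)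
        rw [e1, e2, e3, mix_update, mix_update]
        simp only [h]
        set Φ := mix i (fun c => (x c).1) (fun c => (x c).2.1)
        set Ψ := mix i (fun c => (x c).1) (fun c => (x c).2.2)
        set Φ' := Function.update Φ c (if (c : ℕ) < i then a.1 else a.2.1)
        set Ψ' := Function.update Ψ c (if (c : ℕ) < i then a.1 else a.2.2)
        have := abs_hammingDist_sub_le (x := B Φ) (y := B Ψ) (x' := B Φ') (y' := B Ψ')
        rw [← sq_abs]
        have h3 := pow_le_pow_left₀ (abs_nonneg _) this 2
        nlinarith [sq_nonneg ((hammingDist (B Φ) (B Φ') : ℝ) - hammingDist (B Ψ) (B Ψ'))]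
    _ = 2 * 𝔼 Z, 𝔼 X, 𝔼 a, h (mix i Z X) a + 2 * 𝔼 Z, 𝔼 X, 𝔼 a, h (mix i Z X) a := by
        rw [← expect_arrow_prod (fun Z (W : Fin m → α × α) => 𝔼 a : α × α × α,
          (2 * h (mix i Z (fun c => (W c).1)) (if (c : ℕ) < i then a.1 else a.2.1)
          + 2 * h (mix i Z (fun c => (W c).2)) (if (c : ℕ) < i then a.1 else a.2.2)))]
        have hs : ∀ Z : Fin m → α, _ := fun Z =>
          (expect_arrow_prod (fun (X Y : Fin m → α) => 𝔼 a : α × α × α,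
            (2 * h (mix i Z X) (if (c : ℕ) < i then a.1 else a.2.1)
            + 2 * h (mix i Z Y) (if (c : ℕ) < i then a.1 else a.2.2)))).symm
        simp_rw [hs]
        simp only [expect_add_distrib, ← mul_expect, hX, hY, Fintype.expect_const]
    _ = 4 * 𝔼 Φ, 𝔼 a, h Φ a := by
        rw [expect_mix i fun Φ => 𝔼 a, h Φ a]
        ring

end Interpolation

/-! ### Three correlated runs -/

section ThreeReplicas

variable {α : Type*} {m n : ℕ} [Fintype α] [Nonempty α]

open Classical in
theorem expect_dist_deviation_le (B : (Fin m → α) → (Fin n → Bool)) (i : ℕ) {t : ℝ}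
    (ht : 0 < t) :
    𝔼 Z, 𝔼 X, 𝔼 Y, (if t ≤ |(hammingDist (B (mix i Z X)) (B (mix i Z Y)) : ℝ) - meanDist B i|
      then (1 : ℝ) else 0) ≤ 4 * sensitivity B / t ^ 2 := by
  have h := expect_indicator_le_div_sq
    (fun p : (Fin m → α) × (Fin m → α) × (Fin m → α) =>
      (hammingDist (B (mix i p.1 p.2.1)) (B (mix i p.1 p.2.2)) : ℝ)) ht
  simp only [← univ_product_univ, expect_product] at h
  refine h.trans ?_
  gcongr
  exact variance_dist_le B i

open Classical in
-- Union bound over `T`. For a fixed triple of assignments the positions are independent, so the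
-- probability is a product with one factor for each of the `m` positions.
theorem expect_triple_indicator_le (Sat : (Fin n → Bool) → α → Prop) (i : ℕ)
    (T : Finset ((Fin n → Bool) × (Fin n → Bool) × (Fin n → Bool))) {θ : ℝ}
    (h1 : ∀ σ ∈ T, (𝔼 a, if Sat σ.1 a then (1 : ℝ) else 0) * ((𝔼 a, if Sat σ.2.1 a then 1 else 0)
      * 𝔼 a, if Sat σ.2.2 a then 1 else 0) ≤ θ)
    (h3 : 0 < i → ∀ σ ∈ T,
      (𝔼 a, if Sat σ.1 a ∧ Sat σ.2.1 a ∧ Sat σ.2.2 a then (1 : ℝ) else 0) ≤ θ) :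
    𝔼 Z : Fin m → α, 𝔼 X₁ : Fin m → α, 𝔼 X₂ : Fin m → α, 𝔼 X₃ : Fin m → α, (if ∃ σ ∈ T, (∀ c, Sat σ.1 (mix i Z X₁ c))
        ∧ (∀ c, Sat σ.2.1 (mix i Z X₂ c)) ∧ (∀ c, Sat σ.2.2 (mix i Z X₃ c))
      then (1 : ℝ) else 0) ≤ #T * θ ^ m := by
  have key : ∀ σ ∈ T, 𝔼 Z : Fin m → α, 𝔼 X₁ : Fin m → α, 𝔼 X₂ : Fin m → α, 𝔼 X₃ : Fin m → α, (if (∀ c, Sat σ.1 (mix i Z X₁ c))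
        ∧ (∀ c, Sat σ.2.1 (mix i Z X₂ c)) ∧ (∀ c, Sat σ.2.2 (mix i Z X₃ c))
      then (1 : ℝ) else 0) ≤ θ ^ m := by
    intro σ hσ
    simp only [expect_arrow_prod]
    let J : α → α → α → ℝ := fun x y z =>
      if Sat σ.1 x ∧ Sat σ.2.1 y ∧ Sat σ.2.2 z then 1 else 0
    let g : Fin m → α × α × α × α → ℝ := fun c x => J (if (c : ℕ) < i then x.1 else x.2.1)
      (if (c : ℕ) < i then x.1 else x.2.2.1) (if (c : ℕ) < i then x.1 else x.2.2.2)
    have hg : ∀ x : Fin m → α × α × α × α, (if (∀ c, Sat σ.1 (mix i (fun c => (x c).1)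
          (fun c => (x c).2.1) c))
        ∧ (∀ c, Sat σ.2.1 (mix i (fun c => (x c).1) (fun c => (x c).2.2.1) c))
        ∧ (∀ c, Sat σ.2.2 (mix i (fun c => (x c).1) (fun c => (x c).2.2.2) c))
      then (1 : ℝ) else 0) = ∏ c, g c (x c) := by
      intro x
      simp only [g, J, Fintype.prod_ite_zero, prod_const_one]
      refine if_congr ?_ rfl rfl
      simp only [mix, forall_and]
    simp_rw [hg]
    rw [expect_prod_eval]
    refine (prod_le_prod (fun c _ => expect_nonneg fun x _ => ?_) fun c _ => ?_).trans
      (by rw [prod_const, card_univ, Fintype.card_fin])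
    · simp only [g, J]; split_ifs <;> norm_num
    -- Before position `i` the same clause must suit all three assignments; from there on the three
    -- clauses are independent.
    · by_cases hc : (c : ℕ) < i
      · simp only [g, hc, if_true, ← univ_product_univ, expect_product, Fintype.expect_const]
        exact h3 (by omega) σ hσ
      · have hsplit : ∀ x y z : α, (if Sat σ.1 x ∧ Sat σ.2.1 y ∧ Sat σ.2.2 z then (1 : ℝ) else 0)
            = (if Sat σ.1 x then 1 else 0) * ((if Sat σ.2.1 y then 1 else 0) *
              (if Sat σ.2.2 z then 1 else 0)) := by
          intro x y z
          by_cases h1 : Sat σ.1 x <;> by_cases h2 : Sat σ.2.1 y <;>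
            by_cases h3 : Sat σ.2.2 z <;> simp [h1, h2, h3]
        have hJ : 𝔼 x, 𝔼 y, 𝔼 z, J x y z = (𝔼 a, if Sat σ.1 a then (1 : ℝ) else 0)
            * ((𝔼 a, if Sat σ.2.1 a then 1 else 0) * 𝔼 a, if Sat σ.2.2 a then 1 else 0) := by
          rw [expect_mul]
          refine expect_congr rfl fun x _ => ?_
          rw [expect_mul, mul_expect]
          refine expect_congr rfl fun y _ => ?_
          rw [mul_expect, mul_expect]
          exact expect_congr rfl fun z _ => hsplit x y z
        simp only [g, hc, if_false, ← univ_product_univ, expect_product, Fintype.expect_const]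
        rw [hJ]
        exact h1 σ hσ
  calc _ ≤ 𝔼 Z : Fin m → α, 𝔼 X₁ : Fin m → α, 𝔼 X₂ : Fin m → α, 𝔼 X₃ : Fin m → α, ∑ σ ∈ T, (if (∀ c, Sat σ.1 (mix i Z X₁ c))
        ∧ (∀ c, Sat σ.2.1 (mix i Z X₂ c)) ∧ (∀ c, Sat σ.2.2 (mix i Z X₃ c))
      then (1 : ℝ) else 0) := by
        refine expect_le_expect fun Z _ => expect_le_expect fun X₁ _ =>
          expect_le_expect fun X₂ _ => expect_le_expect fun X₃ _ => ?_
        have hnn : ∀ σ ∈ T, (0 : ℝ) ≤ (if (∀ c, Sat σ.1 (mix i Z X₁ c))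
          ∧ (∀ c, Sat σ.2.1 (mix i Z X₂ c)) ∧ (∀ c, Sat σ.2.2 (mix i Z X₃ c))
          then (1 : ℝ) else 0) := fun σ _ => by split_ifs <;> norm_num
        split_ifs with h
        · obtain ⟨σ, hσ, h⟩ := h
          refine le_trans ?_ (single_le_sum hnn hσ)
          rw [if_pos h]
        · exact sum_nonneg hnn
    _ = ∑ σ ∈ T, 𝔼 Z : Fin m → α, 𝔼 X₁ : Fin m → α, 𝔼 X₂ : Fin m → α, 𝔼 X₃ : Fin m → α, (if (∀ c, Sat σ.1 (mix i Z X₁ c))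
        ∧ (∀ c, Sat σ.2.1 (mix i Z X₂ c)) ∧ (∀ c, Sat σ.2.2 (mix i Z X₃ c))
      then (1 : ℝ) else 0) := by
        simp only [expect_sum_comm]
    _ ≤ ∑ σ ∈ T, θ ^ m := sum_le_sum key
    _ = #T * θ ^ m := by rw [sum_const, nsmul_eq_mul]

open Classical in
/-- If `A` is close to `B` on average then three correlated runs of `A` are all successful and at
the mean pairwise distances of runs of `B` with probability almost the cube of the success
probability of `A`. -/
theorem success_pow_three_le (Sat : (Fin n → Bool) → α → Prop)
    (A B : (Fin m → α) → (Fin n → Bool)) (i : ℕ) {t : ℝ} (ht : 0 < t)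
    (T : Finset ((Fin n → Bool) × (Fin n → Bool) × (Fin n → Bool)))
    (hT : ∀ σ₁ σ₂ σ₃, |(hammingDist σ₁ σ₂ : ℝ) - meanDist B i| < 3 * t →
      |(hammingDist σ₁ σ₃ : ℝ) - meanDist B i| < 3 * t →
      |(hammingDist σ₂ σ₃ : ℝ) - meanDist B i| < 3 * t → (σ₁, σ₂, σ₃) ∈ T) {θ : ℝ}
    (h1 : ∀ σ ∈ T, (𝔼 a, if Sat σ.1 a then (1 : ℝ) else 0) * ((𝔼 a, if Sat σ.2.1 a then 1 else 0)
      * 𝔼 a, if Sat σ.2.2 a then 1 else 0) ≤ θ)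
    (h3 : 0 < i → ∀ σ ∈ T,
      (𝔼 a, if Sat σ.1 a ∧ Sat σ.2.1 a ∧ Sat σ.2.2 a then (1 : ℝ) else 0) ≤ θ) :
    (𝔼 Φ, if ∀ c, Sat (A Φ) (Φ c) then (1 : ℝ) else 0) ^ 3
      ≤ #T * θ ^ m + 3 * (4 * sensitivity B / t ^ 2)
        + 3 * ((𝔼 Φ, (hammingDist (A Φ) (B Φ) : ℝ)) / t) := by
  let s : (Fin m → α) → ℝ := fun Φ => if ∀ c, Sat (A Φ) (Φ c) then 1 else 0
  let V : (Fin m → α) → (Fin m → α) → ℝ := fun Φ Ψ =>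
    if t ≤ |(hammingDist (B Φ) (B Ψ) : ℝ) - meanDist B i| then 1 else 0
  let D : (Fin m → α) → ℝ := fun Φ => if t ≤ (hammingDist (A Φ) (B Φ) : ℝ) then 1 else 0
  let W : (Fin m → α) → (Fin m → α) → (Fin m → α) → ℝ := fun Φ₁ Φ₂ Φ₃ =>
    if ∃ σ ∈ T, (∀ c, Sat σ.1 (Φ₁ c)) ∧ (∀ c, Sat σ.2.1 (Φ₂ c)) ∧ (∀ c, Sat σ.2.2 (Φ₃ c))
      then 1 else 0
  have hs0 : ∀ Φ, 0 ≤ s Φ := fun Φ => by simp only [s]; split_ifs <;> norm_num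
  have hs1 : ∀ Φ, s Φ ≤ 1 := fun Φ => by simp only [s]; split_ifs <;> norm_num
  have hV0 : ∀ Φ Ψ, 0 ≤ V Φ Ψ := fun Φ Ψ => by simp only [V]; split_ifs <;> norm_num
  have hD0 : ∀ Φ, 0 ≤ D Φ := fun Φ => by simp only [D]; split_ifs <;> norm_num
  have hW0 : ∀ Φ₁ Φ₂ Φ₃, 0 ≤ W Φ₁ Φ₂ Φ₃ := fun _ _ _ => by simp only [W]; split_ifs <;> norm_num
  -- If all three runs succeed, and no run of `A` is at distance `t` or more from `B` and no
  -- distance of `B`-outputs deviates by `t` or more, then the distances of the `A`-outputs deviate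
  -- by less than t + 2t, so the outputs form a triple in `T`.
  have point : ∀ Φ₁ Φ₂ Φ₃, s Φ₁ * s Φ₂ * s Φ₃ ≤ W Φ₁ Φ₂ Φ₃ + (V Φ₁ Φ₂ + V Φ₁ Φ₃ + V Φ₂ Φ₃)
      + (D Φ₁ + D Φ₂ + D Φ₃) := by
    intro Φ₁ Φ₂ Φ₃
    have hp : s Φ₁ * s Φ₂ * s Φ₃ ≤ 1 :=
      mul_le_one₀ (mul_le_one₀ (hs1 _) (hs0 _) (hs1 _)) (hs0 _) (hs1 _)
    have a1 := hV0 Φ₁ Φ₂; have a2 := hV0 Φ₁ Φ₃; have a3 := hV0 Φ₂ Φ₃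
    have b1 := hD0 Φ₁; have b2 := hD0 Φ₂; have b3 := hD0 Φ₃
    have c1 := hW0 Φ₁ Φ₂ Φ₃
    by_cases hsat : (∀ c, Sat (A Φ₁) (Φ₁ c)) ∧ (∀ c, Sat (A Φ₂) (Φ₂ c)) ∧ ∀ c, Sat (A Φ₃) (Φ₃ c)
    swap
    · have : s Φ₁ * s Φ₂ * s Φ₃ = 0 := by
        simp only [not_and_or] at hsat
        rcases hsat with h | h | h <;> simp only [s, if_neg h] <;> ring
      linarith
    by_cases d1 : t ≤ (hammingDist (A Φ₁) (B Φ₁) : ℝ)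
    · have : D Φ₁ = 1 := if_pos d1
      linarith
    by_cases d2 : t ≤ (hammingDist (A Φ₂) (B Φ₂) : ℝ)
    · have : D Φ₂ = 1 := if_pos d2
      linarith
    by_cases d3 : t ≤ (hammingDist (A Φ₃) (B Φ₃) : ℝ)
    · have : D Φ₃ = 1 := if_pos d3
      linarith
    by_cases v1 : t ≤ |(hammingDist (B Φ₁) (B Φ₂) : ℝ) - meanDist B i|
    · have : V Φ₁ Φ₂ = 1 := if_pos v1
      linarith
    by_cases v2 : t ≤ |(hammingDist (B Φ₁) (B Φ₃) : ℝ) - meanDist B i|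
    · have : V Φ₁ Φ₃ = 1 := if_pos v2
      linarith
    by_cases v3 : t ≤ |(hammingDist (B Φ₂) (B Φ₃) : ℝ) - meanDist B i|
    · have : V Φ₂ Φ₃ = 1 := if_pos v3
      linarith
    have hd : ∀ Φ Ψ, ¬ t ≤ (hammingDist (A Φ) (B Φ) : ℝ) → ¬ t ≤ (hammingDist (A Ψ) (B Ψ) : ℝ) →
        ¬ t ≤ |(hammingDist (B Φ) (B Ψ) : ℝ) - meanDist B i| →
        |(hammingDist (A Φ) (A Ψ) : ℝ) - meanDist B i| < 3 * t := by
      intro Φ Ψ h h' hv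
      have h2 := abs_hammingDist_sub_le (x := A Φ) (y := A Ψ) (x' := B Φ) (y' := B Ψ)
      have h4 := abs_sub_le (hammingDist (A Φ) (A Ψ) : ℝ) (hammingDist (B Φ) (B Ψ) : ℝ)
        (meanDist B i)
      push Not at h h' hv
      linarith
    have hW : W Φ₁ Φ₂ Φ₃ = 1 :=
      if_pos ⟨(A Φ₁, A Φ₂, A Φ₃), hT _ _ _ (hd _ _ d1 d2 v1) (hd _ _ d1 d3 v2) (hd _ _ d2 d3 v3),
        hsat.1, hsat.2.1, hsat.2.2⟩
    linarith
  have hD : 𝔼 Φ, D Φ ≤ (𝔼 Φ, (hammingDist (A Φ) (B Φ) : ℝ)) / t :=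
    expect_indicator_le_div _ (fun _ => by positivity) ht
  have hV := expect_dist_deviation_le B i ht
  have hW := expect_triple_indicator_le (m := m) Sat i T h1 h3
  -- Given the shared part `Z`, the three runs are independent; Jensen for the cube brings the power
  -- under the average over `Z`.
  calc (𝔼 Φ, s Φ) ^ 3 = (𝔼 Z, 𝔼 X, s (mix i Z X)) ^ 3 := by rw [expect_mix i s]
    _ ≤ 𝔼 Z, (𝔼 X, s (mix i Z X)) ^ 3 :=
        pow_three_expect_le _ fun _ => expect_nonneg fun _ _ => hs0 _
    _ = 𝔼 Z, 𝔼 X₁, 𝔼 X₂, 𝔼 X₃, s (mix i Z X₁) * s (mix i Z X₂) * s (mix i Z X₃) := by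
        simp only [← mul_expect, ← expect_mul]
        exact expect_congr rfl fun _ _ => by ring
    _ ≤ 𝔼 Z, 𝔼 X₁, 𝔼 X₂, 𝔼 X₃, (W (mix i Z X₁) (mix i Z X₂) (mix i Z X₃)
          + (V (mix i Z X₁) (mix i Z X₂) + V (mix i Z X₁) (mix i Z X₃)
            + V (mix i Z X₂) (mix i Z X₃))
          + (D (mix i Z X₁) + D (mix i Z X₂) + D (mix i Z X₃))) :=
        expect_le_expect fun Z _ => expect_le_expect fun X₁ _ =>
          expect_le_expect fun X₂ _ => expect_le_expect fun X₃ _ => point _ _ _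
    _ = 𝔼 Z, 𝔼 X₁, 𝔼 X₂, 𝔼 X₃, W (mix i Z X₁) (mix i Z X₂) (mix i Z X₃)
          + 3 * 𝔼 Z, 𝔼 X, 𝔼 Y, V (mix i Z X) (mix i Z Y) + 3 * 𝔼 Φ, D Φ := by
        simp only [expect_add_distrib, Fintype.expect_const, expect_mix i D]
        ring
    _ ≤ _ := by
        gcongr

end ThreeReplicas

namespace NAESat

/-! ### First moment estimates for one clause and for triples of assignments -/

section ClauseProbabilities

variable {n K : ℕ}

/-- A single clause has a literal with value `1` and a literal with value `0`. -/
def Clause.Satisfied (σ : Fin n → Bool) (C : Clause n K) : Prop :=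
  (∃ j, (C.literal j).eval σ = true) ∧ (∃ j, (C.literal j).eval σ = false)

/-- Violation means that all literals take the same value. For given variables this singles out two
complementary sign patterns among 2^K. -/
theorem Clause.not_satisfied_iff (σ : Fin n → Bool) (C : Clause n K) :
    ¬ C.Satisfied σ ↔ C.2 = (fun j => σ (C.1 j)) ∨ C.2 = (fun j => !σ (C.1 j)) := by
  have h1 : ∀ j, (C.literal j).eval σ = true ↔ C.2 j = σ (C.1 j) := by
    intro j
    cases hb : C.2 j <;> cases hs : σ (C.1 j) <;> simp [Literal.eval, Clause.literal, hb, hs]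
  have h2 : ∀ j, (C.literal j).eval σ = false ↔ C.2 j = !σ (C.1 j) := by
    intro j
    cases hb : C.2 j <;> cases hs : σ (C.1 j) <;> simp [Literal.eval, Clause.literal, hb, hs]
  unfold Clause.Satisfied
  rw [not_and_or, funext_iff, funext_iff]
  have h3 : ∀ j, C.2 j = (!σ (C.1 j)) ↔ ¬ C.2 j = σ (C.1 j) := fun j => by
    generalize C.2 j = b
    cases b <;> cases σ (C.1 j) <;> simp
  simp only [not_exists, h1, h2, h3, not_not]
  exact or_comm

open Classical in
theorem expect_polarity (hK : 0 < K) (a : Fin K → Bool) :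
    𝔼 s : Fin K → Bool, (if s = a ∨ s = (fun j => !a j) then (1 : ℝ) else 0) = 2 / 2 ^ K := by
  rw [Fintype.expect_eq_sum_div_card, sum_boole]
  have : (univ.filter fun s : Fin K → Bool => s = a ∨ s = fun j => !a j)
      = {a, fun j => !a j} := by
    ext s; simp
  rw [this, card_pair]
  · simp
  · intro h
    have := congrFun h ⟨0, hK⟩
    simp at this

open Classical in
theorem expect_not_satisfied (hK : 0 < K) (hn : K ≤ n) (σ : Fin n → Bool) :
    𝔼 C : Clause n K, (if ¬ C.Satisfied σ then (1 : ℝ) else 0) = 2 / 2 ^ K := by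
  have : Nonempty (Fin K ↪ Fin n) := ⟨Fin.castLEEmb hn⟩
  simp only [Clause.not_satisfied_iff, ← univ_product_univ, expect_product]
  simp only [expect_polarity hK (fun j => σ _), Fintype.expect_const]

open Classical in
-- The signs are uniform given the variables, so violation is independent of the choice of
-- variables.
theorem expect_not_satisfied_mul (hK : 0 < K) (σ : Fin n → Bool) (g : (Fin K ↪ Fin n) → ℝ) :
    𝔼 C : Clause n K, (if ¬ C.Satisfied σ then (1 : ℝ) else 0) * g C.1
      = 2 / 2 ^ K * 𝔼 e, g e := by
  simp only [Clause.not_satisfied_iff, ← univ_product_univ, expect_product, ← expect_mul]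
  simp only [expect_polarity hK (fun j => σ _), ← mul_expect]

/-- Drawing without replacement stays inside a given set with at most the probability of drawing
with replacement. -/
theorem descFactorial_mul_pow_le {a n : ℕ} (h : a ≤ n) (K : ℕ) :
    a.descFactorial K * n ^ K ≤ n.descFactorial K * a ^ K := by
  induction K with
  | zero => simp
  | succ k ih =>
    rw [Nat.descFactorial_succ, Nat.descFactorial_succ, pow_succ, pow_succ]
    have h1 : (a - k) * n ≤ (n - k) * a := by
      rw [Nat.sub_mul, Nat.sub_mul, Nat.mul_comm n a]
      exact Nat.sub_le_sub_left (Nat.mul_le_mul_left k h) _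
    calc (a - k) * a.descFactorial k * (n ^ k * n)
        = (a.descFactorial k * n ^ k) * ((a - k) * n) := by ring
      _ ≤ (n.descFactorial k * a ^ k) * ((n - k) * a) := Nat.mul_le_mul ih h1
      _ = _ := by ring

open Classical in
theorem expect_embedding_subset_le (hn : K ≤ n) (hn0 : 0 < n) (A : Finset (Fin n)) :
    𝔼 e : Fin K ↪ Fin n, (if ∀ j, e j ∈ A then (1 : ℝ) else 0) ≤ ((#A : ℝ) / n) ^ K := by
  rw [Fintype.expect_eq_sum_div_card, sum_boole]
  have h1 : #(univ.filter fun e : Fin K ↪ Fin n => ∀ j, e j ∈ A) = (#A).descFactorial K := by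
    have h2 : Fintype.card (Fin K ↪ A) = (#A).descFactorial K := by
      rw [Fintype.card_embedding_eq]; simp
    rw [← h2, ← Fintype.card_coe]
    refine Fintype.card_congr ⟨fun e => ⟨fun j => ⟨e.1 j, (mem_filter.1 e.2).2 j⟩, ?_⟩,
      fun e => ⟨e.trans (Function.Embedding.subtype _), by simp⟩, ?_, ?_⟩
    · intro i j hij
      exact e.1.injective (Subtype.ext_iff.1 hij)
    · intro e; ext; rfl
    · intro e; ext; rfl
  rw [h1, Fintype.card_embedding_eq, Fintype.card_fin, Fintype.card_fin, div_pow,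
    div_le_div_iff₀]
  · have := descFactorial_mul_pow_le (a := #A) (n := n) (by simpa using card_le_univ A) K
    calc ((#A).descFactorial K : ℝ) * (n : ℝ) ^ K = ((#A).descFactorial K * n ^ K : ℕ) := by
          push_cast; ring
      _ ≤ (n.descFactorial K * #A ^ K : ℕ) := by exact_mod_cast this
      _ = _ := by push_cast; ring
  · exact_mod_cast Nat.descFactorial_pos.2 hn
  · positivity

theorem card_disagree (σ τ : Fin n → Bool) :
    #(univ.filter fun i => σ i ≠ τ i) = hammingDist σ τ := rfl

theorem card_agree (σ τ : Fin n → Bool) :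
    #(univ.filter fun i => σ i = τ i) + hammingDist σ τ = n := by
  rw [← card_disagree]
  simpa using card_filter_add_card_filter_not (s := (univ : Finset (Fin n)))
    (fun i => σ i = τ i)

open Classical in
-- One sign pattern can violate both assignments only if they agree on all variables of the clause
-- or differ on all of them. Either set of variables has density at most 199/200: the agreement set
-- by the lower bound on the distance, the other by the upper bound.
theorem expect_both_not_satisfied (hK : 0 < K) (hn : K ≤ n) (σ τ : Fin n → Bool)
    (h1 : (n : ℝ) / 200 ≤ hammingDist σ τ) (h2 : (hammingDist σ τ : ℝ) ≤ n / 100) :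
    𝔼 C : Clause n K, (if ¬ C.Satisfied σ ∧ ¬ C.Satisfied τ then (1 : ℝ) else 0)
      ≤ 2 / 2 ^ K * (2 * (199 / 200) ^ K) := by
  have hn0 : 0 < n := by omega
  have : Nonempty (Fin K ↪ Fin n) := ⟨Fin.castLEEmb hn⟩
  set A : Finset (Fin n) := univ.filter fun i => σ i = τ i with hA
  set D : Finset (Fin n) := univ.filter fun i => σ i ≠ τ i with hD
  have hAD : (#A : ℝ) + hammingDist σ τ = n := by exact_mod_cast card_agree σ τ
  have hDc : (#D : ℝ) = hammingDist σ τ := by exact_mod_cast card_disagree σ τ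
  have hn' : (0 : ℝ) < n := by exact_mod_cast hn0
  have hAle : ((#A : ℝ) / n) ^ K ≤ (199 / 200) ^ K := by
    refine pow_le_pow_left₀ (by positivity) ?_ K
    rw [div_le_iff₀ hn']
    linarith
  have hDle : ((#D : ℝ) / n) ^ K ≤ (199 / 200) ^ K := by
    refine pow_le_pow_left₀ (by positivity) ?_ K
    rw [div_le_iff₀ hn', hDc]
    linarith
  calc _ ≤ 𝔼 C : Clause n K, (if ¬ C.Satisfied σ then (1 : ℝ) else 0) *
        ((if ∀ j, C.1 j ∈ A then 1 else 0) + (if ∀ j, C.1 j ∈ D then 1 else 0)) := by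
        refine expect_le_expect fun C _ => ?_
        have p1 : (0 : ℝ) ≤ if ∀ j, C.1 j ∈ A then 1 else 0 := by split_ifs <;> norm_num
        have p2 : (0 : ℝ) ≤ if ∀ j, C.1 j ∈ D then 1 else 0 := by split_ifs <;> norm_num
        by_cases hs : ¬ C.Satisfied σ
        swap
        · rw [if_neg (fun h => hs h.1), if_neg hs, zero_mul]
        by_cases ht : ¬ C.Satisfied τ
        swap
        · rw [if_neg (fun h => ht h.2), if_pos hs, one_mul]
          positivity
        rw [if_pos ⟨hs, ht⟩, if_pos hs, one_mul]
        rw [Clause.not_satisfied_iff] at hs ht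
        have hdich : (∀ j, C.1 j ∈ A) ∨ ∀ j, C.1 j ∈ D := by
          simp only [hA, hD, mem_filter, mem_univ, true_and]
          rcases hs with hs | hs <;> rcases ht with ht | ht
          · left; intro j
            have := congrFun (hs.symm.trans ht) j
            simpa using this
          · right; intro j
            have := congrFun (hs.symm.trans ht) j
            intro h
            rw [h] at this
            simp at this
          · right; intro j
            have := congrFun (hs.symm.trans ht) j
            intro h
            rw [h] at this
            simp at this
          · left; intro j
            have := congrFun (hs.symm.trans ht) j
            simpa using this
        rcases hdich with h | h
        · rw [if_pos h]; linarith
        · rw [if_pos h]; linarith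
    _ = 2 / 2 ^ K * (𝔼 e : Fin K ↪ Fin n, (if ∀ j, e j ∈ A then (1 : ℝ) else 0)
          + 𝔼 e : Fin K ↪ Fin n, (if ∀ j, e j ∈ D then (1 : ℝ) else 0)) := by
        rw [← expect_add_distrib]
        exact expect_not_satisfied_mul hK σ fun e =>
          (if ∀ j, e j ∈ A then (1 : ℝ) else 0) + (if ∀ j, e j ∈ D then 1 else 0)
    _ ≤ 2 / 2 ^ K * ((199 / 200) ^ K + (199 / 200) ^ K) := by
        gcongr
        · exact (expect_embedding_subset_le hn hn0 A).trans hAle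
        · exact (expect_embedding_subset_le hn hn0 D).trans hDle
    _ = _ := by ring

open Classical in
theorem expect_satisfied (hK : 0 < K) (hn : K ≤ n) (σ : Fin n → Bool) :
    𝔼 C : Clause n K, (if C.Satisfied σ then (1 : ℝ) else 0) = 1 - 2 / 2 ^ K := by
  have : Nonempty (Fin K ↪ Fin n) := ⟨Fin.castLEEmb hn⟩
  rw [← expect_not_satisfied hK hn σ, eq_sub_iff_add_eq, ← expect_add_distrib]
  rw [← Fintype.expect_const (ι := Clause n K) (1 : ℝ)]
  refine expect_congr rfl fun C _ => ?_
  by_cases h : C.Satisfied σ <;> simp [h]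

open Classical in
-- The exponent 3u is weakened to 5u/2 to match the bound for shared clauses.
theorem expect_satisfied_mul_le (hK : 0 < K) (hn : K ≤ n) (σ₁ σ₂ σ₃ : Fin n → Bool) :
    (𝔼 C : Clause n K, if C.Satisfied σ₁ then (1 : ℝ) else 0)
      * ((𝔼 C : Clause n K, if C.Satisfied σ₂ then 1 else 0)
        * 𝔼 C : Clause n K, if C.Satisfied σ₃ then 1 else 0)
      ≤ Real.exp (-(5 / 2 * (2 / 2 ^ K))) := by
  rw [expect_satisfied hK hn, expect_satisfied hK hn, expect_satisfied hK hn]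
  set u : ℝ := 2 / 2 ^ K
  have hu : u ≤ 1 := by
    rw [div_le_one (by positivity)]
    calc (2 : ℝ) = 2 ^ 1 := by norm_num
      _ ≤ 2 ^ K := pow_le_pow_right₀ (by norm_num) hK
  have hu0 : 0 ≤ u := by positivity
  have h1 : 1 - u ≤ Real.exp (-u) := by
    have := Real.add_one_le_exp (-u); linarith
  have h0 : 0 ≤ 1 - u := by linarith
  calc (1 - u) * ((1 - u) * (1 - u)) ≤ Real.exp (-u) * (Real.exp (-u) * Real.exp (-u)) := by
        gcongr
    _ = Real.exp (-(3 * u)) := by rw [← Real.exp_add, ← Real.exp_add]; ring_nf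
    _ ≤ _ := Real.exp_le_exp.2 (by linarith)

open Classical in
-- Inclusion-exclusion up to pairs bounds the probability by 1 - 3u plus three double violations. By
-- `hK2` each of these is at most u/6, which leaves 1 - 5u/2.
theorem expect_three_satisfied_le (hK : 0 < K) (hK2 : 12 * (199 / 200 : ℝ) ^ K ≤ 1) (hn : K ≤ n)
    (σ₁ σ₂ σ₃ : Fin n → Bool)
    (h12 : (n : ℝ) / 200 ≤ hammingDist σ₁ σ₂) (h12' : (hammingDist σ₁ σ₂ : ℝ) ≤ n / 100)
    (h13 : (n : ℝ) / 200 ≤ hammingDist σ₁ σ₃) (h13' : (hammingDist σ₁ σ₃ : ℝ) ≤ n / 100)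
    (h23 : (n : ℝ) / 200 ≤ hammingDist σ₂ σ₃) (h23' : (hammingDist σ₂ σ₃ : ℝ) ≤ n / 100) :
    (𝔼 C : Clause n K, if C.Satisfied σ₁ ∧ C.Satisfied σ₂ ∧ C.Satisfied σ₃ then (1 : ℝ) else 0)
      ≤ Real.exp (-(5 / 2 * (2 / 2 ^ K))) := by
  have : Nonempty (Fin K ↪ Fin n) := ⟨Fin.castLEEmb hn⟩
  have b12 := expect_both_not_satisfied hK hn σ₁ σ₂ h12 h12'
  have b13 := expect_both_not_satisfied hK hn σ₁ σ₃ h13 h13'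
  have b23 := expect_both_not_satisfied hK hn σ₂ σ₃ h23 h23'
  have a1 := expect_not_satisfied hK hn σ₁
  have a2 := expect_not_satisfied hK hn σ₂
  have a3 := expect_not_satisfied hK hn σ₃
  set u : ℝ := 2 / 2 ^ K
  have hu0 : 0 ≤ u := by positivity
  have key : (𝔼 C : Clause n K, if C.Satisfied σ₁ ∧ C.Satisfied σ₂ ∧ C.Satisfied σ₃
      then (1 : ℝ) else 0) ≤ 𝔼 C : Clause n K, (1
      - (if ¬ C.Satisfied σ₁ then (1 : ℝ) else 0) - (if ¬ C.Satisfied σ₂ then (1 : ℝ) else 0)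
      - (if ¬ C.Satisfied σ₃ then (1 : ℝ) else 0)
      + (if ¬ C.Satisfied σ₁ ∧ ¬ C.Satisfied σ₂ then (1 : ℝ) else 0)
      + (if ¬ C.Satisfied σ₁ ∧ ¬ C.Satisfied σ₃ then (1 : ℝ) else 0)
      + (if ¬ C.Satisfied σ₂ ∧ ¬ C.Satisfied σ₃ then (1 : ℝ) else 0)) := by
    refine expect_le_expect fun C _ => ?_
    by_cases c1 : C.Satisfied σ₁ <;> by_cases c2 : C.Satisfied σ₂ <;>
      by_cases c3 : C.Satisfied σ₃ <;> simp only [c1, c2, c3] <;> norm_num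
  refine key.trans ?_
  rw [expect_add_distrib, expect_add_distrib, expect_add_distrib, expect_sub_distrib,
    expect_sub_distrib, expect_sub_distrib, Fintype.expect_const, a1, a2, a3]
  have hexp := Real.add_one_le_exp (-(5 / 2 * u))
  nlinarith

theorem sum_pow_hammingDist (σ : Fin n → Bool) (x : ℝ) :
    ∑ τ : Fin n → Bool, x ^ hammingDist σ τ = (1 + x) ^ n := by
  have h : ∀ τ : Fin n → Bool, x ^ hammingDist σ τ = ∏ i, if σ i ≠ τ i then x else 1 := by
    intro τ
    rw [← card_disagree, prod_ite, prod_const, prod_const_one, mul_one]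
  simp_rw [h]
  rw [← Fintype.piFinset_univ, ← prod_univ_sum (fun _ => (univ : Finset Bool))
    (fun i b => if σ i ≠ b then x else 1)]
  have h2 : ∀ i, ∑ b : Bool, (if σ i ≠ b then x else 1) = 1 + x := by
    intro i
    rw [Fintype.sum_bool]
    cases σ i <;> simp [add_comm]
  simp_rw [h2]
  simp

/-- Chernoff bound with weight 1/32 per disagreement: 32 ≤ 1.036^100 makes every point of the ball
count at least once, and the generating function gives 1.036 · 33/32 < 1.0684. -/
theorem card_hammingBall_le (σ : Fin n → Bool) :
    (#(univ.filter fun τ => (hammingDist σ τ : ℝ) ≤ n / 100) : ℝ) ≤ (1.0684 : ℝ) ^ n := by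
  have h1 : ∀ τ ∈ univ.filter fun τ => (hammingDist σ τ : ℝ) ≤ n / 100,
      (1 : ℝ) ≤ 1.036 ^ n * (1 / 32) ^ hammingDist σ τ := by
    intro τ hτ
    have hτ := (mem_filter.1 hτ).2
    have h100 : 100 * hammingDist σ τ ≤ n := by
      have : (100 : ℝ) * hammingDist σ τ ≤ n := by linarith
      exact_mod_cast this
    rw [one_div, inv_pow, ← div_eq_mul_inv, le_div_iff₀ (by positivity), one_mul]
    calc (32 : ℝ) ^ hammingDist σ τ ≤ (1.036 ^ 100) ^ hammingDist σ τ := by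
          gcongr; norm_num
      _ = 1.036 ^ (100 * hammingDist σ τ) := by rw [pow_mul]
      _ ≤ 1.036 ^ n := pow_le_pow_right₀ (by norm_num) h100
  calc (#(univ.filter fun τ => (hammingDist σ τ : ℝ) ≤ n / 100) : ℝ)
      = ∑ τ ∈ univ.filter fun τ => (hammingDist σ τ : ℝ) ≤ n / 100, (1 : ℝ) := by simp
    _ ≤ ∑ τ ∈ univ.filter fun τ => (hammingDist σ τ : ℝ) ≤ n / 100,
          1.036 ^ n * (1 / 32) ^ hammingDist σ τ := sum_le_sum h1
    _ ≤ ∑ τ, 1.036 ^ n * (1 / 32 : ℝ) ^ hammingDist σ τ :=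
        sum_le_sum_of_subset_of_nonneg (filter_subset _ _) fun _ _ _ => by positivity
    _ = (1.036 * (1 + 1 / 32)) ^ n := by rw [← mul_sum, sum_pow_hammingDist, mul_pow]
    _ ≤ 1.0684 ^ n := by gcongr; norm_num

theorem card_triples_le (T : Finset ((Fin n → Bool) × (Fin n → Bool) × (Fin n → Bool)))
    (hT : ∀ σ ∈ T, (hammingDist σ.1 σ.2.1 : ℝ) ≤ n / 100
      ∧ (hammingDist σ.1 σ.2.2 : ℝ) ≤ n / 100) : (#T : ℝ) ≤ (2.283 : ℝ) ^ n := by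
  have h1 : T ⊆ (univ : Finset (Fin n → Bool)).biUnion fun σ =>
      ({σ} : Finset (Fin n → Bool)) ×ˢ ((univ.filter fun τ => (hammingDist σ τ : ℝ) ≤ n / 100) ×ˢ
        (univ.filter fun τ => (hammingDist σ τ : ℝ) ≤ n / 100)) := by
    intro σ hσ
    simp only [mem_biUnion, mem_univ, true_and, mem_product, mem_singleton, mem_filter]
    exact ⟨σ.1, rfl, hT σ hσ⟩
  calc (#T : ℝ) ≤ ∑ σ : Fin n → Bool, (#(({σ} : Finset (Fin n → Bool)) ×ˢ
        ((univ.filter fun τ => (hammingDist σ τ : ℝ) ≤ n / 100) ×ˢ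
        (univ.filter fun τ => (hammingDist σ τ : ℝ) ≤ n / 100))) : ℝ) := by
        exact_mod_cast (card_le_card h1).trans card_biUnion_le
    _ ≤ ∑ σ : Fin n → Bool, (1.0684 : ℝ) ^ n * 1.0684 ^ n := by
        refine sum_le_sum fun σ _ => ?_
        rw [card_product, card_product, card_singleton, one_mul, Nat.cast_mul]
        gcongr <;> exact card_hammingBall_le σ
    _ = (2 * (1.0684 * 1.0684)) ^ n := by
        rw [sum_const, card_univ]
        simp [mul_pow]
    _ ≤ 2.283 ^ n := by gcongr; norm_num

end ClauseProbabilities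

end NAESat

namespace NAESat

/-! ### The overlap gap defeats stable maps -/

section OverlapGap

variable {n K m : ℕ}

/-- With u = 2/2^K, the exponent 5u/2 · m is at least (5/4) n ln 2 up to the rounding of `m`, which
costs at most a factor exp(5/2) because u ≤ 1. -/
theorem card_mul_pow_le (hK : 0 < K) (hm : (2 : ℝ) ^ K / 4 * Real.log 2 * n ≤ m + 1)
    {N : ℝ} (hN : N ≤ (2.283 : ℝ) ^ n) :
    N * Real.exp (-(5 / 2 * (2 / 2 ^ K))) ^ m
      ≤ Real.exp (5 / 2) * (2.283 * Real.exp (-(5 / 4 * Real.log 2))) ^ n := by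
  have h1 : Real.exp (-(5 / 2 * (2 / 2 ^ K))) ^ m
      ≤ Real.exp (5 / 2) * Real.exp (-(5 / 4 * Real.log 2)) ^ n := by
    rw [← Real.exp_nat_mul, ← Real.exp_nat_mul, ← Real.exp_add]
    refine Real.exp_le_exp.2 ?_
    have hu : (2 : ℝ) / 2 ^ K ≤ 1 := by
      rw [div_le_one (by positivity)]
      calc (2 : ℝ) = 2 ^ 1 := by norm_num
        _ ≤ 2 ^ K := pow_le_pow_right₀ (by norm_num) hK
    have hu0 : (0 : ℝ) < 2 / 2 ^ K := by positivity
    have h2 := mul_le_mul_of_nonneg_left hm hu0.le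
    have h3 : (2 : ℝ) / 2 ^ K * (2 ^ K / 4 * Real.log 2 * n) = Real.log 2 * n / 2 := by
      field_simp; ring
    rw [h3] at h2
    nlinarith
  calc N * Real.exp (-(5 / 2 * (2 / 2 ^ K))) ^ m
      ≤ 2.283 ^ n * (Real.exp (5 / 2) * Real.exp (-(5 / 4 * Real.log 2)) ^ n) := by
        gcongr
    _ = _ := by rw [mul_pow]; ring

/-- Discrete intermediate value argument: at the first index where the mean distance is at most `v`,
its previous value exceeded `v`, and one step is too short to jump below `u`. -/
theorem exists_intermediate_meanDist {α : Type*} [Fintype α] [Nonempty α]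
    (B : (Fin m → α) → (Fin n → Bool)) {u v : ℝ} (hv : 0 ≤ v) (h0 : v < meanDist B 0)
    (hs : 2 * √(sensitivity B) ≤ v - u) : ∃ i, u ≤ meanDist B i ∧ meanDist B i ≤ v := by
  classical
  have hex : ∃ i, meanDist B i ≤ v := ⟨m, by rw [meanDist_last]; exact hv⟩
  have hfind : Nat.find hex ≠ 0 := by
    intro h
    have := Nat.find_spec hex
    rw [h] at this
    linarith
  obtain ⟨i, hi⟩ := Nat.exists_eq_succ_of_ne_zero hfind
  have h1 : ¬ meanDist B i ≤ v := Nat.find_min hex (by omega)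
  have h2 : meanDist B (i + 1) ≤ v := by
    have := Nat.find_spec hex
    rwa [hi] at this
  have him : i < m := by
    have : Nat.find hex ≤ m := Nat.find_min' hex (by rw [meanDist_last]; exact hv)
    omega
  refine ⟨i + 1, ?_, h2⟩
  have h3 := (abs_le.1 (abs_meanDist_sub_le B ⟨i, him⟩)).2
  simp only at h3
  linarith

open Classical in
/-- A map on formulas that is close, on average, to a map of small sensitivity has a small
probability of producing a satisfying assignment. -/
theorem success_pow_three_le_of_approx (hK : 0 < K) (hK2 : 12 * (199 / 200 : ℝ) ^ K ≤ 1)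
    (hn : K ≤ n) (hm : (2 : ℝ) ^ K / 4 * Real.log 2 * n ≤ m + 1)
    (A B : Formula n K m → (Fin n → Bool)) {C δ : ℝ} (hs : sensitivity B ≤ C * n)
    (hAB : 𝔼 Φ, (hammingDist (A Φ) (B Φ) : ℝ) ≤ δ * n) (hC : 2 * √(C * n) ≤ n / 800) :
    (𝔼 Φ : Formula n K m, if Φ.Satisfies (A Φ) then (1 : ℝ) else 0) ^ 3
      ≤ Real.exp (5 / 2) * (2.283 * Real.exp (-(5 / 4 * Real.log 2))) ^ n
        + 12 * 2400 ^ 2 * C / n + 7200 * δ := by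
  have : Nonempty (Fin K ↪ Fin n) := ⟨Fin.castLEEmb hn⟩
  have hn0 : (0 : ℝ) < n := by exact_mod_cast (by omega : 0 < n)
  -- With t = n/2400 the tolerance 3t is n/800. The target window [n/160, 3n/400] = [5n/800, 6n/800]
  -- has width n/800, so no interpolation step jumps over it; enlarged by the tolerance it stays
  -- within [n/200, n/100].
  have ht : (0 : ℝ) < n / 2400 := by positivity
  have hsq : 2 * √(sensitivity B) ≤ n / 800 :=
    le_trans (by gcongr) hC
  have finish : ∀ (i : ℕ) (T : Finset ((Fin n → Bool) × (Fin n → Bool) × (Fin n → Bool))),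
      (∀ σ₁ σ₂ σ₃, |(hammingDist σ₁ σ₂ : ℝ) - meanDist B i| < 3 * (n / 2400) →
      |(hammingDist σ₁ σ₃ : ℝ) - meanDist B i| < 3 * (n / 2400) →
      |(hammingDist σ₂ σ₃ : ℝ) - meanDist B i| < 3 * (n / 2400) → (σ₁, σ₂, σ₃) ∈ T) →
      (∀ σ ∈ T, (hammingDist σ.1 σ.2.1 : ℝ) ≤ n / 100
        ∧ (hammingDist σ.1 σ.2.2 : ℝ) ≤ n / 100) →
      (0 < i → ∀ σ ∈ T,
        (𝔼 C : Clause n K, if C.Satisfied σ.1 ∧ C.Satisfied σ.2.1 ∧ C.Satisfied σ.2.2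
          then (1 : ℝ) else 0) ≤ Real.exp (-(5 / 2 * (2 / 2 ^ K)))) →
      (𝔼 Φ : Formula n K m, if Φ.Satisfies (A Φ) then (1 : ℝ) else 0) ^ 3
      ≤ Real.exp (5 / 2) * (2.283 * Real.exp (-(5 / 4 * Real.log 2))) ^ n
        + 12 * 2400 ^ 2 * C / n + 7200 * δ := by
    intro i T hT hcard h3
    have h := success_pow_three_le (fun σ (C : Clause n K) => C.Satisfied σ) A B i ht T hT
      (fun σ _ => expect_satisfied_mul_le hK hn _ _ _) h3
    refine le_trans (le_of_eq ?_) (h.trans ?_)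
    · exact congrArg (· ^ 3) (expect_congr rfl fun Φ _ => if_congr Iff.rfl rfl rfl)
    refine add_le_add (add_le_add (card_mul_pow_le hK hm (card_triples_le T hcard)) ?_) ?_
    · calc 3 * (4 * sensitivity B / ((n : ℝ) / 2400) ^ 2)
          ≤ 3 * (4 * (C * n) / ((n : ℝ) / 2400) ^ 2) := by gcongr
        _ = 12 * 2400 ^ 2 * C / n := by field_simp; ring
    · calc 3 * ((𝔼 Φ, (hammingDist (A Φ) (B Φ) : ℝ)) / (n / 2400))
          ≤ 3 * ((δ * n) / (n / 2400)) := by gcongr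
        _ = 7200 * δ := by field_simp; ring
  -- If independent inputs already give close outputs, `i = 0` is used: no clause is shared, so no
  -- lower bound on the distances is needed.
  by_cases h0 : meanDist B 0 ≤ 3 / 400 * n
  · refine finish 0 (univ.filter fun σ => (hammingDist σ.1 σ.2.1 : ℝ) ≤ n / 100
        ∧ (hammingDist σ.1 σ.2.2 : ℝ) ≤ n / 100) ?_ ?_ ?_
    · intro σ₁ σ₂ σ₃ h12 h13 _
      rw [mem_filter]
      have a1 := (abs_lt.1 h12).2
      have a2 := (abs_lt.1 h13).2
      exact ⟨mem_univ _, by simp only; linarith, by simp only; linarith⟩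
    · intro σ hσ
      exact (mem_filter.1 hσ).2
    · intro h; exact absurd h (lt_irrefl _)
  · obtain ⟨i, hi1, hi2⟩ := exists_intermediate_meanDist B (u := 1 / 160 * n) (v := 3 / 400 * n)
      (by positivity) (not_le.1 h0) (by linarith)
    refine finish i (univ.filter fun σ =>
        ((n : ℝ) / 200 ≤ hammingDist σ.1 σ.2.1 ∧ (hammingDist σ.1 σ.2.1 : ℝ) ≤ n / 100)
        ∧ ((n : ℝ) / 200 ≤ hammingDist σ.1 σ.2.2 ∧ (hammingDist σ.1 σ.2.2 : ℝ) ≤ n / 100)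
        ∧ ((n : ℝ) / 200 ≤ hammingDist σ.2.1 σ.2.2
          ∧ (hammingDist σ.2.1 σ.2.2 : ℝ) ≤ n / 100)) ?_ ?_ ?_
    · intro σ₁ σ₂ σ₃ h12 h13 h23
      rw [mem_filter]
      rw [abs_lt] at h12 h13 h23
      refine ⟨mem_univ _, ⟨?_, ?_⟩, ⟨?_, ?_⟩, ⟨?_, ?_⟩⟩ <;> simp only <;> linarith
    · intro σ hσ
      have := (mem_filter.1 hσ).2
      exact ⟨this.1.2, this.2.1.2⟩
    · intro _ σ hσ
      obtain ⟨⟨a, b⟩, ⟨c, d⟩, ⟨e, f⟩⟩ := (mem_filter.1 hσ).2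
      exact expect_three_satisfied_le hK hK2 hn _ _ _ a b c d e f

theorem exp_mul_lt_one : 2.283 * Real.exp (-(5 / 4 * Real.log 2)) < 1 := by
  -- The fourth power turns the claim into 2.283^4 < 2^5.
  have h : (2.283 * Real.exp (-(5 / 4 * Real.log 2))) ^ 4 < 1 := by
    rw [mul_pow, ← Real.exp_nat_mul]
    have : ((4 : ℕ) : ℝ) * -(5 / 4 * Real.log 2) = Real.log ((2 ^ 5)⁻¹) := by
      rw [Real.log_inv, Real.log_pow]; push_cast; ring
    rw [this, Real.exp_log (by positivity)]
    norm_num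
  by_contra hcon
  push Not at hcon
  have := one_le_pow₀ hcon (n := 4)
  linarith

end OverlapGap

end NAESat

/-! ### Bounded distance along a relation -/

section WithinDist

variable {β : Type*} {r r' : β → β → Prop}

/-- `y` can be reached from `x` by at most `t` steps of the relation `r`. -/
def WithinDist (r : β → β → Prop) : ℕ → β → β → Prop
  | 0, x, y => x = y
  | t + 1, x, y => x = y ∨ ∃ z, r x z ∧ WithinDist r t z y

theorem WithinDist.refl (t : ℕ) (x : β) : WithinDist r t x x := by
  cases t with
  | zero => rfl
  | succ t => exact Or.inl rfl

theorem WithinDist.step {t : ℕ} {x y z : β} (h : r x y) (h' : WithinDist r t y z) :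
    WithinDist r (t + 1) x z := Or.inr ⟨y, h, h'⟩

theorem WithinDist.single {t : ℕ} {x y : β} (h : r x y) : WithinDist r (t + 1) x y :=
  .step h (.refl t y)

theorem WithinDist.mono {s t : ℕ} (hst : s ≤ t) {x y : β} (h : WithinDist r s x y) :
    WithinDist r t x y := by
  induction s generalizing t x with
  | zero => cases h; exact .refl t _
  | succ s ih =>
    obtain ⟨t, rfl⟩ : ∃ t', t = t' + 1 := ⟨t - 1, by omega⟩
    rcases h with rfl | ⟨z, hz, h⟩
    · exact .refl _ _
    · exact .step hz (ih (by omega) h)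

theorem WithinDist.trans {s t : ℕ} {x y z : β} (h : WithinDist r s x y)
    (h' : WithinDist r t y z) : WithinDist r (s + t) x z := by
  induction s generalizing x with
  | zero => cases h; simpa using h'
  | succ s ih =>
    rcases h with rfl | ⟨w, hw, h⟩
    · exact h'.mono (by omega)
    · exact (WithinDist.step hw (ih h)).mono (by omega)

theorem WithinDist.symm (hr : ∀ x y, r x y → r y x) {t : ℕ} {x y : β}
    (h : WithinDist r t x y) : WithinDist r t y x := by
  induction t generalizing x with
  | zero => exact Eq.symm h
  | succ t ih =>
    rcases h with rfl | ⟨z, hz, h⟩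
    · exact .refl _ _
    · exact (ih h).trans (.single (t := 0) (hr _ _ hz))

/-- A path of length `t` never leaves the ball of radius `t`, so only edges inside the ball matter.
This serves to restrict paths to subgraphs and to compare two formulas that agree near a vertex. -/
theorem WithinDist.of_forall {t : ℕ} {x y : β} (h : WithinDist r t x y)
    (hr : ∀ z w, WithinDist r t x z → WithinDist r t x w → r z w → r' z w) :
    WithinDist r' t x y := by
  induction t generalizing x with
  | zero => exact h
  | succ t ih =>
    rcases h with rfl | ⟨z, hz, h⟩
    · exact .refl _ _
    · exact .step (hr _ _ (.refl _ _) (.single hz) hz)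
        (ih h fun u w hu hw => hr u w (.step hz hu) (.step hz hw))

end WithinDist

namespace NAESat

/-! ### Locality of survey propagation and of decimation -/

section Locality

variable {n K m : ℕ}

/-- The variable `x` occurs in the clause `a`. -/
def Occurs (Φ : Formula n K m) (x : Fin n) (a : Fin m) : Prop := ∃ j, (Φ a).1 j = x

/-- Adjacency in the factor graph of a formula. -/
def FactorAdj (Φ : Formula n K m) : Fin n ⊕ Fin m → Fin n ⊕ Fin m → Prop
  | .inl x, .inr a => Occurs Φ x a
  | .inr a, .inl x => Occurs Φ x a
  | _, _ => False

theorem FactorAdj.symm (Φ : Formula n K m) : ∀ v w, FactorAdj Φ v w → FactorAdj Φ w v := by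
  rintro (x | a) (y | b) h <;> exact h

/-- All literals of the reduced formula `ψ` come from the formula `Φ`. -/
def IsReductOf (ψ : ReducedFormula n m) (Φ : Formula n K m) : Prop :=
  ∀ a, ∀ l ∈ ψ.lits a, Occurs Φ l.1 a

theorem lits_congr {ψ ψ' : ReducedFormula n m} {a : Fin m} (h : ψ a = ψ' a) :
    ψ.lits a = ψ'.lits a := by
  simp only [ReducedFormula.lits, h]

theorem lits_eq_of_some {ψ : ReducedFormula n m} {a : Fin m} {C : ReducedClause n}
    (h : ψ a = some C) : ψ.lits a = C.lits := by
  simp only [ReducedFormula.lits, h]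

variable {Φ : Formula n K m} {ψ ψ' : ReducedFormula n m}

theorem mem_lits_congr (hψ : IsReductOf ψ Φ) (hψ' : IsReductOf ψ' Φ) {x : Fin n}
    (h : ∀ c, Occurs Φ x c → ψ c = ψ' c) (c : Fin m) (b : Bool) :
    (x, b) ∈ ψ.lits c ↔ (x, b) ∈ ψ'.lits c := by
  by_cases hc : Occurs Φ x c
  · rw [lits_congr (h c hc)]
  · exact ⟨fun h => absurd (hψ c _ h) hc, fun h => absurd (hψ' c _ h) hc⟩

/-- Each iteration looks two edges further in the factor graph: the messages at `x` use those at the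
other variables of its clauses. The seeds are common to both formulas. -/
theorem messagesAt_congr (hψ : IsReductOf ψ Φ) (hψ' : IsReductOf ψ' Φ) (q : Seeds n m) (t : ℕ)
    (x : Fin n) (h : ∀ c, WithinDist (FactorAdj Φ) (2 * t + 1) (.inl x) (.inr c) → ψ c = ψ' c)
    (a : Fin m) (ha : Occurs Φ x a) :
    (messagesAt ψ q t).varU x a = (messagesAt ψ' q t).varU x a
      ∧ (messagesAt ψ q t).varS x a = (messagesAt ψ' q t).varS x a
      ∧ (messagesAt ψ q t).clS a x = (messagesAt ψ' q t).clS a x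
      ∧ (messagesAt ψ q t).clU a x = (messagesAt ψ' q t).clU a x := by
  induction t generalizing x a with
  | zero => exact ⟨rfl, rfl, rfl, rfl⟩
  | succ t ih =>
    set Q := messagesAt ψ q t with hQ
    set Q' := messagesAt ψ' q t with hQ'
    have hx : ∀ c, Occurs Φ x c → ψ c = ψ' c := fun c hc => h c (.single hc)
    have hm := mem_lits_congr hψ hψ' hx
    have hsame : ψ.sameClauses x a = ψ'.sameClauses x a := by
      ext c; simp only [ReducedFormula.sameClauses, mem_filter, hm]
    have hopp : ψ.oppClauses x a = ψ'.oppClauses x a := by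
      ext c; simp only [ReducedFormula.oppClauses, mem_filter, hm]
    have hQx : ∀ c, Occurs Φ x c → Q.clS c x = Q'.clS c x ∧ Q.clU c x = Q'.clU c x :=
      fun c hc => (ih x (fun c hc => h c (hc.mono (by omega))) c hc).2.2
    have hsame' : ∀ c ∈ ψ'.sameClauses x a, Occurs Φ x c := by
      intro c hc
      obtain ⟨_, -, b, -, hb⟩ := mem_filter.1 hc
      exact hψ' c _ hb
    have hopp' : ∀ c ∈ ψ'.oppClauses x a, Occurs Φ x c := by
      intro c hc
      obtain ⟨_, -, b, -, hb⟩ := mem_filter.1 hc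
      exact hψ' c _ hb
    have hStar : nextRStar ψ Q x a = nextRStar ψ' Q' x a := by
      unfold nextRStar
      rw [hsame, hopp]
      congr 1
      · exact prod_congr rfl fun c hc => by
          rw [(hQx c (hopp' c hc)).1, (hQx c (hopp' c hc)).2]
      · exact prod_congr rfl fun c hc => by
          rw [(hQx c (hsame' c hc)).1, (hQx c (hsame' c hc)).2]
    have hS : nextRS ψ Q x a = nextRS ψ' Q' x a := by
      unfold nextRS
      rw [hsame, hopp, hStar]
      congr 2
      · exact prod_congr rfl fun c hc => by rw [(hQx c (hopp' c hc)).1]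
      · exact prod_congr rfl fun c hc => by rw [(hQx c (hsame' c hc)).2]
    have hU : nextRU ψ Q x a = nextRU ψ' Q' x a := by
      unfold nextRU
      rw [hsame, hopp, hStar]
      congr 2
      · exact prod_congr rfl fun c hc => by rw [(hQx c (hopp' c hc)).2]
      · exact prod_congr rfl fun c hc => by rw [(hQx c (hsame' c hc)).1]
    have hvar : ∀ y, Occurs Φ y a → Q.varU y a = Q'.varU y a ∧ Q.varS y a = Q'.varS y a := by
      intro y hy
      have := ih y (fun c hc => h c ?_) a hy
      · exact ⟨this.1, this.2.1⟩
      · exact (WithinDist.step (y := .inr a) ha (WithinDist.step (y := .inl y) hy hc)).mono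
          (by omega)
    have haψ := hx a ha
    refine ⟨?_, ?_, ?_, ?_⟩
    · change nextRU ψ Q x a / _ = nextRU ψ' Q' x a / _
      rw [hU, hS, hStar]
    · change nextRS ψ Q x a / _ = nextRS ψ' Q' x a / _
      rw [hU, hS, hStar]
    · change nextClS ψ Q a x = nextClS ψ' Q' a x
      unfold nextClS
      rw [← haψ]
      rcases hC : ψ a with _ | C
      · rfl
      · simp only
        congr 1
        refine prod_congr rfl fun l hl => (hvar _ (hψ a l ?_)).1
        rw [lits_eq_of_some hC]
        exact (mem_filter.1 hl).1
    · change nextClU ψ Q a x = nextClU ψ' Q' a x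
      unfold nextClU
      rw [← haψ]
      rcases hC : ψ a with _ | C
      · rfl
      · simp only
        congr 1
        refine prod_congr rfl fun l hl => (hvar _ (hψ a l ?_)).2
        rw [lits_eq_of_some hC]
        exact (mem_filter.1 hl).1

theorem spDecision_congr (hψ : IsReductOf ψ Φ) (hψ' : IsReductOf ψ' Φ) (r : ℕ) (q : Seeds n m)
    (x : Fin n)
    (h : ∀ c, WithinDist (FactorAdj Φ) (2 * r + 1) (.inl x) (.inr c) → ψ c = ψ' c) :
    spDecision r ψ q x = spDecision r ψ' q x := by
  have hx : ∀ c, Occurs Φ x c → ψ c = ψ' c := fun c hc => h c (.single hc)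
  have hm := mem_lits_congr hψ hψ' hx
  have hpos : ψ.posClauses x = ψ'.posClauses x := by
    ext c; simp only [ReducedFormula.posClauses, mem_filter, hm]
  have hneg : ψ.negClauses x = ψ'.negClauses x := by
    ext c; simp only [ReducedFormula.negClauses, mem_filter, hm]
  set Q := messagesAt ψ q r with hQ
  set Q' := messagesAt ψ' q r with hQ'
  have hQx : ∀ c, Occurs Φ x c → Q.clS c x = Q'.clS c x ∧ Q.clU c x = Q'.clU c x :=
    fun c hc => (messagesAt_congr hψ hψ' q r x h c hc).2.2
  have hpos' : ∀ c ∈ ψ'.posClauses x, Occurs Φ x c := fun c hc => hψ' c _ (mem_filter.1 hc).2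
  have hneg' : ∀ c ∈ ψ'.negClauses x, Occurs Φ x c := fun c hc => hψ' c _ (mem_filter.1 hc).2
  have hStar : rawWStar ψ Q x = rawWStar ψ' Q' x := by
    unfold rawWStar
    rw [hpos, hneg]
    congr 1
    · exact prod_congr rfl fun c hc => by
        rw [(hQx c (hpos' c hc)).1, (hQx c (hpos' c hc)).2]
    · exact prod_congr rfl fun c hc => by
        rw [(hQx c (hneg' c hc)).1, (hQx c (hneg' c hc)).2]
  have hOne : rawWOne ψ Q x = rawWOne ψ' Q' x := by
    unfold rawWOne
    rw [hpos, hneg, hStar]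
    congr 2
    · exact prod_congr rfl fun c hc => by rw [(hQx c (hneg' c hc)).1]
    · exact prod_congr rfl fun c hc => by rw [(hQx c (hpos' c hc)).2]
  have hZero : rawWZero ψ Q x = rawWZero ψ' Q' x := by
    unfold rawWZero
    rw [hpos, hneg, hStar]
    congr 2
    · exact prod_congr rfl fun c hc => by rw [(hQx c (hpos' c hc)).1]
    · exact prod_congr rfl fun c hc => by rw [(hQx c (hneg' c hc)).2]
  unfold spDecision WZero WOne
  simp only [← hQ, ← hQ', hOne, hZero, hStar]

/-- The decimation process started from an arbitrary reduced formula. -/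
noncomputable def decimateFrom (r : ℕ) (ψ : ReducedFormula n m) (ω : Fin n → Seeds n m) :
    ℕ → ReducedFormula n m
  | 0 => ψ
  | i + 1 =>
    if h : i < n then
      (decimateFrom r ψ ω i).assign ⟨i, h⟩
        (spDecision r (decimateFrom r ψ ω i) (ω ⟨i, h⟩) ⟨i, h⟩)
    else decimateFrom r ψ ω i

theorem decimatedFormula_eq_decimateFrom (r : ℕ) (Φ : Formula n K m) (ω : Fin n → Seeds n m)
    (i : ℕ) : decimatedFormula r Φ ω i = decimateFrom r Φ.toReduced ω i := by
  induction i with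
  | zero => rfl
  | succ i ih => simp only [decimatedFormula, decimateFrom, ih]

theorem ReducedClause.lits_assign_subset {C D : ReducedClause n} {x : Fin n} {b : Bool}
    (h : C.assign x b = some D) : D.lits ⊆ C.lits := by
  unfold ReducedClause.assign at h
  simp only at h
  split_ifs at h <;> cases h <;> simp

theorem ReducedClause.assign_of_notMem {C : ReducedClause n} {x : Fin n}
    (h : ∀ b, (x, b) ∉ C.lits) (b : Bool) : C.assign x b = some C := by
  unfold ReducedClause.assign
  simp [h]

theorem IsReductOf.assign (hψ : IsReductOf ψ Φ) (x : Fin n) (b : Bool) :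
    IsReductOf (ψ.assign x b) Φ := by
  intro a l hl
  simp only [ReducedFormula.lits, ReducedFormula.assign] at hl
  rcases hC : ψ a with _ | C
  · simp [hC] at hl
  · simp only [hC, Option.bind_some] at hl
    rcases hD : C.assign x b with _ | D
    · simp [hD] at hl
    · simp only [hD] at hl
      refine hψ a l ?_
      rw [lits_eq_of_some hC]
      exact ReducedClause.lits_assign_subset hD hl

theorem IsReductOf.decimateFrom (hψ : IsReductOf ψ Φ) (r : ℕ) (ω : Fin n → Seeds n m) (i : ℕ) :
    IsReductOf (decimateFrom r ψ ω i) Φ := by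
  induction i with
  | zero => exact hψ
  | succ i ih =>
    simp only [NAESat.decimateFrom]
    split_ifs
    · exact ih.assign _ _
    · exact ih

theorem assign_of_not_occurs (hψ : IsReductOf ψ Φ) {x : Fin n} {a : Fin m}
    (h : ¬ Occurs Φ x a) (b : Bool) : ψ.assign x b a = ψ a := by
  simp only [ReducedFormula.assign]
  rcases hC : ψ a with _ | C
  · rfl
  · rw [Option.bind_some]
    refine ReducedClause.assign_of_notMem (fun b hb => h ?_) b
    refine hψ a (x, b) ?_
    rwa [lits_eq_of_some hC]

/-- The decision at the variable `j` may depend directly on that at the earlier variable `i`. -/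
def DependsOn (r : ℕ) (Φ : Formula n K m) (j i : Fin n) : Prop :=
  i < j ∧ WithinDist (FactorAdj Φ) (2 * r + 2) (.inl j) (.inl i)

/-- Setting variable `i` alters a clause near `j` only if `i` occurs in it. Then `j` depends on `i`,
so `i` also lies on a dependency chain from `k`, and the induction hypothesis around `i` makes the
two decisions equal. -/
theorem decimateFrom_congr (hψ : IsReductOf ψ Φ) (hψ' : IsReductOf ψ' Φ) (r : ℕ)
    (ω : Fin n → Seeds n m) (k : Fin n)
    (h : ∀ j, Relation.ReflTransGen (DependsOn r Φ) k j →
      ∀ a, WithinDist (FactorAdj Φ) (2 * r + 1) (.inl j) (.inr a) → ψ a = ψ' a) (i : ℕ)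
    (j : Fin n) (hj : Relation.ReflTransGen (DependsOn r Φ) k j) (hij : i ≤ j) (a : Fin m)
    (ha : WithinDist (FactorAdj Φ) (2 * r + 1) (.inl j) (.inr a)) :
    decimateFrom r ψ ω i a = decimateFrom r ψ' ω i a := by
  induction i generalizing j a with
  | zero => exact h j hj a ha
  | succ i ih =>
    have hi : i < n := by have := j.2; omega
    simp only [decimateFrom, hi, dif_pos]
    have hr := hψ.decimateFrom r ω i
    have hr' := hψ'.decimateFrom r ω i
    by_cases hocc : Occurs Φ ⟨i, hi⟩ a
    · have hdep : DependsOn r Φ j ⟨i, hi⟩ :=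
        ⟨by rw [Fin.lt_def]; exact hij, ha.trans
          (.single (t := 0) (show FactorAdj Φ (.inr a) (.inl ⟨i, hi⟩) from hocc))⟩
      have hdec := spDecision_congr hr hr' r (ω ⟨i, hi⟩) ⟨i, hi⟩
        (fun c hc => ih ⟨i, hi⟩ (hj.tail hdep) le_rfl c hc)
      simp only [ReducedFormula.assign]
      rw [hdec, ih j hj (by omega) a ha]
    · rw [assign_of_not_occurs hr hocc, assign_of_not_occurs hr' hocc]
      exact ih j hj (by omega) a ha

theorem isReductOf_toReduced (Φ : Formula n K m) : IsReductOf Φ.toReduced Φ := by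
  intro a l hl
  simp only [ReducedFormula.lits, Formula.toReduced, mem_image, mem_univ, true_and] at hl
  obtain ⟨j, rfl⟩ := hl
  exact ⟨j, rfl⟩

open Classical in
/-- The reduced formula that consists of the clauses of `Φ` with names in `S`. -/
noncomputable def Formula.restrictTo (Φ : Formula n K m) (S : Set (Fin m)) : ReducedFormula n m :=
  fun a => if a ∈ S then Φ.toReduced a else none

theorem isReductOf_restrictTo (Φ : Formula n K m) (S : Set (Fin m)) :
    IsReductOf (Φ.restrictTo S) Φ := by
  intro a l hl
  by_cases ha : a ∈ S
  · refine isReductOf_toReduced Φ a l ?_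
    rwa [lits_congr (show Φ.restrictTo S a = Φ.toReduced a from if_pos ha)] at hl
  · simp [ReducedFormula.lits, Formula.restrictTo, ha] at hl

/-- The decision at each variable `k` when the decimation only sees the clauses within distance `T`
of `k` in the factor graph. -/
noncomputable def localDecimation (r T : ℕ) (ω : Fin n → Seeds n m) (Φ : Formula n K m) :
    Fin n → Bool := fun k =>
  spDecision r (decimateFrom r
    (Φ.restrictTo {a | WithinDist (FactorAdj Φ) T (.inl k) (.inr a)}) ω k) (ω k) k

theorem spDecimation_eq_localDecimation (r T : ℕ) (ω : Fin n → Seeds n m) (Φ : Formula n K m)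
    (k : Fin n) (h : ∀ j, Relation.ReflTransGen (DependsOn r Φ) k j →
      WithinDist (FactorAdj Φ) T (.inl k) (.inl j)) :
    spDecimation r Φ ω k = localDecimation r (T + (2 * r + 1)) ω Φ k := by
  unfold spDecimation localDecimation
  rw [decimatedFormula_eq_decimateFrom]
  have h1 := isReductOf_toReduced Φ
  have h2 := isReductOf_restrictTo Φ
    {a | WithinDist (FactorAdj Φ) (T + (2 * r + 1)) (.inl k) (.inr a)}
  refine spDecision_congr (h1.decimateFrom r ω k) (h2.decimateFrom r ω k) r (ω k) k
    fun c hc => decimateFrom_congr h1 h2 r ω k (fun j hj a ha => ?_) k k .refl le_rfl c hc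
  exact (if_pos ((h j hj).trans ha)).symm

/-- If `c` is out of reach, no path in the ball uses an edge at `c`, so replacing that clause breaks
none of them. -/
theorem withinDist_update_iff (Φ : Formula n K m) (c : Fin m) (C : Clause n K) (T : ℕ)
    (v : Fin n ⊕ Fin m) (h : ¬ WithinDist (FactorAdj Φ) T v (.inr c))
    (w : Fin n ⊕ Fin m) (hw : WithinDist (FactorAdj Φ) T v w) :
    WithinDist (FactorAdj (Function.update Φ c C)) T v w := by
  refine hw.of_forall fun z y hz hy hzy => ?_
  have hzc : z ≠ .inr c := by rintro rfl; exact h hz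
  have hyc : y ≠ .inr c := by rintro rfl; exact h hy
  rcases z with x | a <;> rcases y with y | b
  · exact hzy
  · have : b ≠ c := fun h => hyc (by rw [h])
    simpa [FactorAdj, Occurs, this] using hzy
  · have : a ≠ c := fun h => hzc (by rw [h])
    simpa [FactorAdj, Occurs, this] using hzy
  · exact hzy

theorem localDecimation_update (r T : ℕ) (ω : Fin n → Seeds n m) (Φ : Formula n K m) (c : Fin m)
    (C : Clause n K) (k : Fin n) (h : ¬ WithinDist (FactorAdj Φ) T (.inl k) (.inr c))
    (h' : ¬ WithinDist (FactorAdj (Function.update Φ c C)) T (.inl k) (.inr c)) :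
    localDecimation r T ω Φ k = localDecimation r T ω (Function.update Φ c C) k := by
  have hS : {a | WithinDist (FactorAdj Φ) T (.inl k) (.inr a)}
      = {a | WithinDist (FactorAdj (Function.update Φ c C)) T (.inl k) (.inr a)} := by
    ext a
    refine ⟨fun ha => withinDist_update_iff Φ c C T _ h _ ha, fun ha => ?_⟩
    have := withinDist_update_iff (Function.update Φ c C) c (Φ c) T _ h' _ ha
    simpa using this
  unfold localDecimation
  rw [← hS]
  congr 2
  funext a
  by_cases ha : WithinDist (FactorAdj Φ) T (.inl k) (.inr a)
  · have hac : a ≠ c := by rintro rfl; exact h ha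
    simp [Formula.restrictTo, ha, Formula.toReduced, hac]
  · simp [Formula.restrictTo, ha]

end Locality

end NAESat

/-! ### Trees grown along escaping chains -/

section Grown

variable {β : Type*} {r : β → β → Prop} {W : ℕ}

/-- The list `l` lists (newest first) the vertices of a tree that has been grown by attaching each
new vertex to one of the `W` preceding vertices. -/
inductive Grown (r : β → β → Prop) (W : ℕ) : List β → Prop
  | single (v : β) : Grown r W [v]
  | cons {x : β} {l : List β} (hl : Grown r W l) (hx : x ∉ l)
      (h : ∃ y ∈ l.take W, r x y) : Grown r W (x :: l)

theorem Grown.of_append {s l : List β} (h : Grown r W (s ++ l)) (hl : l ≠ []) :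
    Grown r W l := by
  induction s with
  | nil => exact h
  | cons x s ih =>
    refine ih ?_
    rw [List.cons_append] at h
    generalize hm : x :: (s ++ l) = m at h
    cases h with
    | single v =>
      have : s ++ l = [] := by simpa using (List.cons.inj hm).2
      simp [hl] at this
    | cons h1 _ _ =>
      rw [(List.cons.inj hm).2]
      exact h1

theorem Grown.withinDist {l : List β} (h : Grown r W l) {v x : β} (hv : l.getLast? = some v)
    (hx : x ∈ l) : WithinDist r l.length x v := by
  induction h generalizing x with
  | single w =>
    simp only [List.getLast?_singleton, Option.some.injEq] at hv
    simp only [List.mem_singleton] at hx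
    subst hv hx
    exact .refl _ _
  | @cons y l hl hy h ih =>
    have hne : l ≠ [] := by cases hl <;> simp
    have hv' : l.getLast? = some v := by
      rwa [List.getLast?_cons_of_ne_nil hne] at hv
    rcases List.mem_cons.1 hx with rfl | hx
    · obtain ⟨z, hz, hr⟩ := h
      exact .step hr (ih hv' (List.mem_of_mem_take hz))
    · exact (ih hv' hx).mono (by simp)

/-- A path from `p` to the newest segment `α` is attached starting at its far end. The first new
vertex has its parent in `α`, which fits in the window; every later one has its parent at the head
of the list. Avoiding `U` excludes repetitions there; if `p` was already attached, the list is cut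
back to it. -/
theorem Grown.extend (hW : 0 < W) {α U : List β} (hα : α.length ≤ W)
    (hg : Grown r W (α ++ U)) {t : ℕ} {p w : β} (hw : w ∈ α)
    (h : WithinDist (fun x y => r x y ∧ x ∉ U ∧ y ∉ U) t p w) :
    ∃ s, Grown r W (s ++ (α ++ U)) ∧ s.length ≤ t
      ∧ ((s = [] ∧ p ∈ α) ∨ ∃ s', s = p :: s') := by
  induction t generalizing p with
  | zero => cases h; exact ⟨[], hg, by simp, Or.inl ⟨rfl, hw⟩⟩
  | succ t ih =>
    by_cases hp : p ∈ α
    · exact ⟨[], hg, by simp, Or.inl ⟨rfl, hp⟩⟩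
    rcases h with rfl | ⟨z, ⟨hz, hpU, -⟩, h⟩
    · exact absurd hw hp
    obtain ⟨s, hs, hlen, hcase⟩ := ih h
    by_cases hps : p ∈ s
    · obtain ⟨s₁, s₂, rfl⟩ := List.append_of_mem hps
      refine ⟨p :: s₂, ?_, ?_, Or.inr ⟨s₂, rfl⟩⟩
      · rw [List.append_assoc] at hs
        exact hs.of_append (by simp)
      · rw [List.length_append] at hlen
        omega
    · refine ⟨p :: s, .cons hs ?_ ⟨z, ?_, hz⟩, by simpa using hlen, Or.inr ⟨s, rfl⟩⟩
      · change p ∉ s ++ (α ++ U)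
        simp only [List.mem_append, not_or]
        exact ⟨hps, hp, hpU⟩
      · obtain ⟨W, rfl⟩ : ∃ W', W = W' + 1 := ⟨W - 1, by omega⟩
        rcases hcase with ⟨rfl, hzα⟩ | ⟨s', rfl⟩
        · change z ∈ List.take (W + 1) (α ++ U)
          rw [List.take_append]
          rw [List.take_of_length_le hα]
          exact List.mem_append_left _ hzα
        · simp

/-- The path from `c` is attached to `k`, then the path from `k'` to the result; the first piece has
at most T + 1 vertices, whence the window. -/
theorem Grown.exists_of_withinDist {T : ℕ} {k c k' : β} (h : WithinDist r T c k)
    (h' : WithinDist r T k' c) :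
    ∃ l, Grown r (T + 1) l ∧ l.length ≤ 2 * T + 1 ∧ k ∈ l ∧ c ∈ l ∧ k' ∈ l := by
  have hres : ∀ {t : ℕ} {x y : β}, WithinDist r t x y →
      WithinDist (fun x y => r x y ∧ x ∉ ([] : List β) ∧ y ∉ ([] : List β)) t x y :=
    fun h => h.of_forall fun _ _ _ _ h => ⟨h, by simp, by simp⟩
  obtain ⟨s, hs, hlen, hcase⟩ := Grown.extend (α := [k]) (U := []) (Nat.succ_pos T) (by simp)
    (.single k) (List.mem_singleton_self k) (hres h)
  rw [List.append_nil] at hs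
  have hc : c ∈ s ++ [k] := by
    rcases hcase with ⟨rfl, hc⟩ | ⟨s', rfl⟩
    · simpa using hc
    · simp
  obtain ⟨s₂, hs₂, hlen₂, hcase₂⟩ := Grown.extend (α := s ++ [k]) (U := []) (Nat.succ_pos T)
    (by simpa using hlen) (by simpa using hs) hc (hres h')
  rw [List.append_nil] at hs₂
  refine ⟨s₂ ++ (s ++ [k]), hs₂, ?_, by simp, List.mem_append_right _ hc, ?_⟩
  · simp only [List.length_append, List.length_singleton]; omega
  · rcases hcase₂ with ⟨rfl, hc⟩ | ⟨s', rfl⟩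
    · simpa using hc
    · simp

/-- Taking the last exit from `P` ensures that the whole remaining chain stays outside. -/
theorem exists_last_crossing {γ : Type*} {T : γ → γ → Prop} {P : γ → Prop} {p e : γ}
    (h : Relation.ReflTransGen T p e) (hp : P p) (he : ¬ P e) :
    ∃ q q', Relation.ReflTransGen T p q ∧ P q ∧ T q q' ∧ ¬ P q' ∧
      Relation.ReflTransGen (fun x y => T x y ∧ ¬ P x ∧ ¬ P y) q' e := by
  suffices hs : (¬ P p ∧ Relation.ReflTransGen (fun x y => T x y ∧ ¬ P x ∧ ¬ P y) p e) ∨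
      ∃ q q', Relation.ReflTransGen T p q ∧ P q ∧ T q q' ∧ ¬ P q' ∧
        Relation.ReflTransGen (fun x y => T x y ∧ ¬ P x ∧ ¬ P y) q' e by
    rcases hs with hs | hs
    · exact absurd hp hs.1
    · exact hs
  clear hp
  induction h using Relation.ReflTransGen.head_induction_on with
  | refl => exact Or.inl ⟨he, .refl⟩
  | head hab hbe ih =>
    rename_i a b
    rcases ih with ⟨hb, hpath⟩ | ⟨q, q', h1, h2⟩
    · by_cases ha : P a
      · exact Or.inr ⟨a, b, .refl, ha, hab, hb, hpath⟩
      · exact Or.inl ⟨ha, .head ⟨hab, ha, hb⟩ hpath⟩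
    · exact Or.inr ⟨q, q', .head hab h1, h2⟩

variable {γ : Type*} [LinearOrder γ]

/-- A decreasing chain with jumps of length at most `R` that leaves a large ball around its starting
point yields a grown list with `L + 1` marked vertices in decreasing order. -/
theorem exists_grown_of_escape (hr : ∀ x y, r x y → r y x) (f : γ → β) {R : ℕ} (hR : 0 < R)
    (L : ℕ) {k e : γ}
    (hke : Relation.ReflTransGen (fun j i => i < j ∧ WithinDist r R (f j) (f i)) k e)
    (hfar : ¬ WithinDist r (2 * R * L + 1 + R) (f k) (f e)) :
    ∃ (l : List β) (ps : List γ), Grown r (2 * R) l ∧ l.length ≤ 2 * R * L + 1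
      ∧ l.getLast? = some (f k) ∧ ps.length = L + 1 ∧ ps.Pairwise (· < ·)
      ∧ (ps.map f).Sublist l := by
  -- Invariant: `α` is the newest segment and contains the current chain point, `U` holds the older
  -- vertices, and the rest of the chain keeps a distance greater than `R` from `U`. Jumps made from
  -- now on therefore cannot touch `U`.
  suffices hs : ∀ s ≤ L, ∃ (α U : List β) (p : γ) (ps : List γ),
      Grown r (2 * R) (α ++ U) ∧ α.length ≤ 2 * R ∧ (α ++ U).length ≤ 2 * R * s + 1
      ∧ f p ∈ α ∧ (α ++ U).getLast? = some (f k) ∧ (p :: ps).length = s + 1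
      ∧ (p :: ps).Pairwise (· < ·) ∧ ((p :: ps).map f).Sublist (α ++ U)
      ∧ (∀ u ∈ U, ¬ WithinDist r R (f p) u)
      ∧ Relation.ReflTransGen (fun j i => (i < j ∧ WithinDist r R (f j) (f i))
        ∧ (∀ u ∈ U, ¬ WithinDist r R (f j) u) ∧ (∀ u ∈ U, ¬ WithinDist r R (f i) u)) p e by
    obtain ⟨α, U, p, ps, h1, -, h2, -, h3, h4, h5, h6, -⟩ := hs L le_rfl
    exact ⟨α ++ U, p :: ps, h1, h2, h3, h4, h5, h6⟩
  intro s hs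
  induction s with
  | zero =>
    refine ⟨[f k], [], k, [], .single _, ?_, ?_, by simp, by simp, by simp, by simp, by simp,
      by simp, ?_⟩
    · simp only [List.length_singleton]; omega
    · simp
    · simpa using hke
  | succ s ih =>
    obtain ⟨α, U, p, ps, hg, hα, hlen, hpα, hlast, hps, hsort, hsub, hpU, hpath⟩ :=
      ih (by omega)
    -- The grown list stays within 2Rs + 1 of its root, so the far end of the chain is not within
    -- `R` of any of its vertices, and the chain must leave the neighbourhood of `α`.
    have hefar : ∀ u ∈ α ++ U, ¬ WithinDist r R (f e) u := by
      intro u hu hd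
      refine hfar ?_
      have h1 := hg.withinDist hlast hu
      have h2 := (hd.trans h1).symm hr
      refine h2.mono ?_
      have : 2 * R * s ≤ 2 * R * L := Nat.mul_le_mul_left _ (by omega)
      omega
    obtain ⟨q, q', hpq, ⟨w, hwα, hqw⟩, ⟨⟨hq'q, hqq'⟩, hqU, hq'U⟩, hq'α, hq'e⟩ :=
      exists_last_crossing (P := fun x => ∃ u ∈ α, WithinDist r R (f x) u) hpath
        ⟨f p, hpα, .refl _ _⟩
        (fun ⟨u, hu, h⟩ => hefar u (List.mem_append_left _ hu) h)
    have hqp : q ≤ p := by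
      clear hqw hq'q hqq' hqU hq'U
      induction hpq with
      | refl => exact le_rfl
      | tail _ h ih => exact h.1.1.le.trans ih
    have hfar' : ∀ x, (∀ u ∈ U, ¬ WithinDist r R (f x) u) →
        (¬ ∃ u ∈ α, WithinDist r R (f x) u) → ∀ u ∈ α ++ U, ¬ WithinDist r R (f x) u := by
      intro x h1 h2 u hu hd
      rcases List.mem_append.1 hu with hu | hu
      · exact h2 ⟨u, hu, hd⟩
      · exact h1 u hu hd
    have hres : ∀ y, WithinDist r R (f q) y →
        WithinDist (fun x y => r x y ∧ x ∉ U ∧ y ∉ U) R (f q) y := fun y hy =>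
      hy.of_forall fun z w hz hw h => ⟨h, fun hzU => hqU z hzU hz, fun hwU => hqU w hwU hw⟩
    -- The walk from `f q'` through `f q` to `w` has at most 2R steps and stays within `R` of `f q`,
    -- hence off `U`.
    have hwalk : WithinDist (fun x y => r x y ∧ x ∉ U ∧ y ∉ U) (2 * R) (f q') w := by
      have h1 := (hres _ hqq').symm fun x y h => ⟨hr _ _ h.1, h.2.2, h.2.1⟩
      exact (h1.trans (hres _ hqw)).mono (by omega)
    obtain ⟨β', hβ, hβlen, hcase⟩ := hg.extend (by omega) hα hwα hwalk
    have hq'notin : f q' ∉ α := fun h => hq'α ⟨_, h, .refl _ _⟩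
    rcases hcase with ⟨-, h⟩ | ⟨s', rfl⟩
    · exact absurd h hq'notin
    have hne : α ++ U ≠ [] := by
      intro h
      rw [h] at hlast
      simp at hlast
    refine ⟨f q' :: s', α ++ U, q', p :: ps, hβ, hβlen, ?_, by simp, ?_, by simpa using hps,
      ?_, ?_, hfar' q' hq'U hq'α, ?_⟩
    · rw [List.length_append]
      have : 2 * R * (s + 1) = 2 * R * s + 2 * R := by ring
      omega
    · rw [List.getLast?_append, hlast]
      rfl
    · rw [List.pairwise_cons]
      refine ⟨?_, hsort⟩
      intro x hx
      rcases List.mem_cons.1 hx with rfl | hx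
      · exact lt_of_lt_of_le hq'q hqp
      · exact (lt_of_lt_of_le hq'q hqp).trans ((List.pairwise_cons.1 hsort).1 x hx)
    · rw [List.map_cons, List.cons_append]
      exact (hsub.trans (List.sublist_append_right _ _)).cons_cons _
    · refine Relation.ReflTransGen.mono ?_ _ _ hq'e
      rintro x y ⟨⟨hd, hx, hy⟩, hx', hy'⟩
      exact ⟨hd, hfar' x hx hx', hfar' y hy hy'⟩

end Grown

namespace NAESat

/-! ### Probability that a given tree occurs in the factor graph -/

section EdgeProbabilities

variable {n K m : ℕ}

open Classical in
/-- The probability that a random embedding hits all points of `B`. -/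
noncomputable def coverProb (K n : ℕ) (B : Finset (Fin n)) : ℝ :=
  𝔼 e : Fin K ↪ Fin n, if ∀ v ∈ B, ∃ j, e j = v then (1 : ℝ) else 0

theorem coverProb_nonneg (B : Finset (Fin n)) : 0 ≤ coverProb K n B :=
  expect_nonneg fun _ _ => by split_ifs <;> norm_num

theorem coverProb_insert_eq (B : Finset (Fin n)) {v w : Fin n} (hv : v ∉ B) (hw : w ∉ B) :
    coverProb K n (insert v B) = coverProb K n (insert w B) := by
  refine Fintype.expect_equiv ((Equiv.refl (Fin K)).embeddingCongr (Equiv.swap v w)) _ _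
    fun e => if_congr ?_ rfl rfl
  have hB : ∀ u ∈ B, Equiv.swap v w u = u := fun u hu =>
    Equiv.swap_apply_of_ne_of_ne (fun h => hv (h ▸ hu)) (fun h => hw (h ▸ hu))
  have he : ∀ j u, ((Equiv.refl (Fin K)).embeddingCongr (Equiv.swap v w) e) j = u
      ↔ e j = Equiv.swap v w u := by
    intro j u
    rw [Equiv.embeddingCongr_apply]
    simp [Equiv.swap_apply_eq_iff]
  simp only [forall_mem_insert, he, Equiv.swap_apply_right]
  refine and_congr Iff.rfl (forall₂_congr fun u hu => ?_)
  rw [hB u hu]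

/-- Double counting of the points outside `B`: by symmetry each is hit together with `B` equally
often, and an embedding that covers `B` hits only K - #B further points. Finally (K - b)/(n - b) ≤
K/n. -/
theorem coverProb_insert_le (hn : K ≤ n) (B : Finset (Fin n)) {v : Fin n} (hv : v ∉ B) :
    coverProb K n (insert v B) ≤ K / n * coverProb K n B := by
  classical
  have hn0 : 0 < n := lt_of_le_of_lt (Nat.zero_le _) v.2
  have hlt : #B < n := by
    have := card_lt_card (ssubset_univ_iff.2 (fun h => hv (h ▸ mem_univ v) : B ≠ univ))
    simpa using this
  have h1 : ∑ w ∈ Bᶜ, coverProb K n (insert w B) = (n - #B : ℝ) * coverProb K n (insert v B) := by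
    rw [sum_congr rfl fun w hw => coverProb_insert_eq B (mem_compl.1 hw) hv, sum_const,
      nsmul_eq_mul, card_compl, Fintype.card_fin, Nat.cast_sub hlt.le]
  have h2 : ∑ w ∈ Bᶜ, coverProb K n (insert w B) ≤ (K - #B : ℝ) * coverProb K n B := by
    unfold coverProb
    rw [← expect_sum_comm, mul_expect]
    refine expect_le_expect fun e _ => ?_
    by_cases hB : ∀ u ∈ B, ∃ j, e j = u
    · rw [if_pos hB, mul_one]
      have hsub : B ⊆ univ.map e := fun u hu => by simpa using hB u hu
      have hcard : #(univ.map e \ B) = K - #B := by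
        rw [card_sdiff_of_subset hsub, card_map, card_univ, Fintype.card_fin]
      have hle : #B ≤ K := by simpa using card_le_card hsub
      rw [← Nat.cast_sub hle, ← hcard]
      rw [sum_boole]
      refine Nat.cast_le.2 (card_le_card fun w hw => ?_)
      rw [mem_filter] at hw
      have hw1 : w ∈ univ.map e := by simpa using hw.2 w (mem_insert_self _ _)
      exact Finset.mem_sdiff.2 ⟨hw1, mem_compl.1 hw.1⟩
    · rw [if_neg hB, mul_zero]
      refine (sum_eq_zero fun w _ => if_neg fun h => hB fun u hu => ?_).le
      exact h u (mem_insert_of_mem hu)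
  have h3 := h1 ▸ h2
  have hp := coverProb_nonneg (K := K) B
  have hb : (0 : ℝ) < n - #B := by
    have : (#B : ℝ) < n := by exact_mod_cast hlt
    linarith
  have hn' : (0 : ℝ) < n := by exact_mod_cast hn0
  have hKn : (K : ℝ) ≤ n := by exact_mod_cast hn
  rw [div_mul_eq_mul_div, le_div_iff₀ hn']
  refine le_of_mul_le_mul_left ?_ hb
  calc (n - #B : ℝ) * (coverProb K n (insert v B) * n)
      = ((n - #B : ℝ) * coverProb K n (insert v B)) * n := by ring
    _ ≤ ((K - #B : ℝ) * coverProb K n B) * n := by gcongr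
    _ = ((K - #B : ℝ) * n) * coverProb K n B := by ring
    _ ≤ ((n - #B : ℝ) * K) * coverProb K n B := by
        gcongr ?_ * _
        have : (#B : ℝ) * K ≤ #B * n := by gcongr
        linarith
    _ = _ := by ring

theorem coverProb_le (hn : K ≤ n) (B : Finset (Fin n)) :
    coverProb K n B ≤ ((K : ℝ) / n) ^ #B := by
  classical
  induction B using Finset.induction_on with
  | empty =>
    have : Nonempty (Fin K ↪ Fin n) := ⟨Fin.castLEEmb hn⟩
    simp [coverProb]
  | insert v B hv ih =>
    rw [card_insert_of_notMem hv, pow_succ']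
    exact (coverProb_insert_le hn B hv).trans (by gcongr)

open Classical in
-- Different clauses are independent; within one clause the edges are negatively correlated by
-- `coverProb_le`.
theorem expect_edges_le (hn : K ≤ n) (E : Finset (Fin n × Fin m)) :
    𝔼 Φ : Formula n K m, (if ∀ e ∈ E, Occurs Φ e.1 e.2 then (1 : ℝ) else 0)
      ≤ ((K : ℝ) / n) ^ #E := by
  have : Nonempty (Fin K ↪ Fin n) := ⟨Fin.castLEEmb hn⟩
  let B : Fin m → Finset (Fin n) := fun a => univ.filter fun v => (v, a) ∈ E
  have hB : ∑ a, #(B a) = #E := by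
    rw [card_eq_sum_card_fiberwise (f := Prod.snd) (t := univ) (fun _ _ => by simp)]
    refine sum_congr rfl fun a _ => ?_
    refine card_bij (fun v _ => (v, a)) ?_ ?_ ?_
    · intro v hv
      simpa [B] using hv
    · intro v _ w _ h
      exact (Prod.mk.inj h).1
    · rintro ⟨v, b⟩ h
      rw [mem_filter] at h
      obtain ⟨h1, h2⟩ := h
      simp only at h2
      subst h2
      exact ⟨v, by simpa [B] using h1, rfl⟩
  have hprod : ∀ Φ : Formula n K m, (if ∀ e ∈ E, Occurs Φ e.1 e.2 then (1 : ℝ) else 0)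
      = ∏ a, if ∀ v ∈ B a, ∃ j, (Φ a).1 j = v then (1 : ℝ) else 0 := by
    intro Φ
    rw [Fintype.prod_ite_zero]
    simp only [prod_const_one]
    refine if_congr ?_ rfl rfl
    constructor
    · intro h a v hv
      exact h (v, a) (by simpa [B] using hv)
    · rintro h ⟨v, a⟩ he
      exact h a v (by simpa [B] using he)
  simp_rw [hprod]
  rw [expect_prod_eval (fun a (C : Clause n K) =>
    if ∀ v ∈ B a, ∃ j, C.1 j = v then (1 : ℝ) else 0)]
  have hcl : ∀ a, 𝔼 C : Clause n K, (if ∀ v ∈ B a, ∃ j, C.1 j = v then (1 : ℝ) else 0)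
      = coverProb K n (B a) := by
    intro a
    let g : (Fin K ↪ Fin n) → ℝ := fun e => if ∀ v ∈ B a, ∃ j, e j = v then 1 else 0
    change 𝔼 C : Clause n K, g C.1 = 𝔼 e, g e
    rw [← univ_product_univ, expect_product]
    simp
  simp_rw [hcl]
  rw [← hB, ← prod_pow_eq_pow_sum]
  exact prod_le_prod (fun a _ => coverProb_nonneg _) fun a _ => coverProb_le hn _

open Classical in
-- Induction removing the newest vertex: it has at most `W` possible parents, and each choice
-- contributes one edge of probability K/n. `E` stores the edges already extracted; each has an
-- endpoint off the remaining list, so a new edge is never counted twice.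
theorem expect_grown_and_edges_le (hn : K ≤ n) (W : ℕ) (l : List (Fin n ⊕ Fin m))
    (E : Finset (Fin n × Fin m)) (hE : ∀ e ∈ E, ¬ (.inl e.1 ∈ l ∧ .inr e.2 ∈ l)) :
    𝔼 Φ : Formula n K m, (if Grown (FactorAdj Φ) W l ∧ ∀ e ∈ E, Occurs Φ e.1 e.2
      then (1 : ℝ) else 0) ≤ (W * K / n) ^ (l.length - 1) * ((K : ℝ) / n) ^ #E := by
  induction l generalizing E with
  | nil =>
    have : ∀ Φ : Formula n K m, ¬ Grown (FactorAdj Φ) W [] := fun Φ h => by cases h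
    simp only [this, false_and, if_false, expect_const_zero]
    positivity
  | cons x l ih =>
    rcases l.eq_nil_or_concat with rfl | hne
    · refine le_trans (expect_le_expect fun Φ _ => ?_) ((expect_edges_le hn E).trans_eq (by simp))
      split_ifs with h1 h2
      · exact le_rfl
      · exact absurd h1.2 h2
      · norm_num
      · exact le_rfl
    have hne : l ≠ [] := by
      obtain ⟨_, _, rfl⟩ := hne
      simp
    by_cases hx : x ∈ l
    · have : ∀ Φ : Formula n K m, ¬ Grown (FactorAdj Φ) W (x :: l) := fun Φ h => by
        cases h with
        | single => exact hne rfl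
        | cons _ h _ => exact h hx
      simp only [this, false_and, if_false, expect_const_zero]
      positivity
    have hinv : ∀ Φ : Formula n K m, Grown (FactorAdj Φ) W (x :: l) →
        Grown (FactorAdj Φ) W l ∧ ∃ y ∈ (l.take W).toFinset, FactorAdj Φ x y := fun Φ h => by
      cases h with
      | single => exact absurd rfl hne
      | cons h1 _ h2 => exact ⟨h1, by simpa using h2⟩
    have key : ∀ y ∈ (l.take W).toFinset, 𝔼 Φ : Formula n K m,
        (if (Grown (FactorAdj Φ) W l ∧ ∀ e ∈ E, Occurs Φ e.1 e.2) ∧ FactorAdj Φ x y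
          then (1 : ℝ) else 0)
        ≤ (W * K / n) ^ (l.length - 1) * ((K : ℝ) / n) ^ (#E + 1) := by
      intro y hy
      have hyl : y ∈ l := List.mem_of_mem_take (List.mem_toFinset.1 hy)
      have step : ∀ v a, (∀ Φ : Formula n K m, FactorAdj Φ x y ↔ Occurs Φ v a) →
          .inl v ∈ x :: l → .inr a ∈ x :: l → ¬ (.inl v ∈ l ∧ .inr a ∈ l) →
          𝔼 Φ : Formula n K m,
          (if (Grown (FactorAdj Φ) W l ∧ ∀ e ∈ E, Occurs Φ e.1 e.2) ∧ FactorAdj Φ x y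
            then (1 : ℝ) else 0)
          ≤ (W * K / n) ^ (l.length - 1) * ((K : ℝ) / n) ^ (#E + 1) := by
        intro v a hva hv ha hnot
        have hnotE : (v, a) ∉ E := fun h => hE _ h ⟨hv, ha⟩
        rw [← card_insert_of_notMem hnotE]
        refine le_trans (le_of_eq (expect_congr rfl fun Φ _ => if_congr ?_ rfl rfl))
          (ih (insert (v, a) E) ?_)
        · rw [forall_mem_insert, hva]
          tauto
        · intro e he
          rcases mem_insert.1 he with rfl | he
          · exact hnot
          · exact fun h => hE e he ⟨List.mem_cons_of_mem _ h.1, List.mem_cons_of_mem _ h.2⟩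
      have trivial_case : (∀ Φ : Formula n K m, ¬ FactorAdj Φ x y) → 𝔼 Φ : Formula n K m,
          (if (Grown (FactorAdj Φ) W l ∧ ∀ e ∈ E, Occurs Φ e.1 e.2) ∧ FactorAdj Φ x y
            then (1 : ℝ) else 0)
          ≤ (W * K / n) ^ (l.length - 1) * ((K : ℝ) / n) ^ (#E + 1) := by
        intro h
        simp only [h, and_false, if_false, expect_const_zero]
        positivity
      rcases x with v | a <;> rcases y with w | b
      · exact trivial_case fun Φ h => h
      · exact step v b (fun Φ => Iff.rfl) (by simp) (List.mem_cons_of_mem _ hyl)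
          (fun h => hx h.1)
      · exact step w a (fun Φ => Iff.rfl) (List.mem_cons_of_mem _ hyl) (by simp)
          (fun h => hx h.2)
      · exact trivial_case fun Φ h => h
    have hcard : (#(l.take W).toFinset : ℝ) ≤ W := by
      exact_mod_cast (List.toFinset_card_le _).trans (by simp)
    calc _ ≤ 𝔼 Φ : Formula n K m, ∑ y ∈ (l.take W).toFinset,
          (if (Grown (FactorAdj Φ) W l ∧ ∀ e ∈ E, Occurs Φ e.1 e.2) ∧ FactorAdj Φ x y
            then (1 : ℝ) else 0) := by
          refine expect_le_expect fun Φ _ => ?_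
          have hnn : ∀ y ∈ (l.take W).toFinset, (0 : ℝ) ≤
            (if (Grown (FactorAdj Φ) W l ∧ ∀ e ∈ E, Occurs Φ e.1 e.2) ∧ FactorAdj Φ x y
              then (1 : ℝ) else 0) := fun y _ => by split_ifs <;> norm_num
          split_ifs with h
          · obtain ⟨hg, y, hy, hxy⟩ := hinv Φ h.1
            refine le_trans ?_ (single_le_sum hnn hy)
            rw [if_pos ⟨⟨hg, h.2⟩, hxy⟩]
          · exact sum_nonneg hnn
      _ = ∑ y ∈ (l.take W).toFinset, 𝔼 Φ : Formula n K m,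
          (if (Grown (FactorAdj Φ) W l ∧ ∀ e ∈ E, Occurs Φ e.1 e.2) ∧ FactorAdj Φ x y
            then (1 : ℝ) else 0) := expect_sum_comm _ _ _
      _ ≤ ∑ y ∈ (l.take W).toFinset,
          (W * K / n) ^ (l.length - 1) * ((K : ℝ) / n) ^ (#E + 1) := sum_le_sum key
      _ ≤ W * ((W * K / n) ^ (l.length - 1) * ((K : ℝ) / n) ^ (#E + 1)) := by
          rw [sum_const, nsmul_eq_mul]
          gcongr
      _ = (W * K / n) ^ (l.length - 1 + 1) * ((K : ℝ) / n) ^ #E := by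
          rw [pow_succ, pow_succ]; ring
      _ = _ := by
          rw [List.length_cons, Nat.sub_add_cancel (List.length_pos_iff.2 hne),
            Nat.add_sub_cancel]

open Classical in
theorem expect_grown_le (hn : K ≤ n) (W : ℕ) (l : List (Fin n ⊕ Fin m)) :
    𝔼 Φ : Formula n K m, (if Grown (FactorAdj Φ) W l then (1 : ℝ) else 0)
      ≤ (W * K / n) ^ (l.length - 1) := by
  have h := expect_grown_and_edges_le hn W l ∅ (by simp)
  simpa using h

end EdgeProbabilities

end NAESat

/-! ### Counting lists with a prescribed sublist -/

section Lists

variable {V : Type*} [Fintype V]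

theorem sum_ofFn_succ {N : ℕ} (F : List V → ℝ) :
    ∑ u : Fin (N + 1) → V, F (List.ofFn u) = ∑ x, ∑ u : Fin N → V, F (x :: List.ofFn u) := by
  rw [← Fintype.sum_prod_type']
  refine (Fintype.sum_equiv (Fin.consEquiv (fun _ => V)) _ _ fun p => ?_).symm
  simp [Fin.consEquiv, List.ofFn_succ]

variable [DecidableEq V]

/-- There are at most 2^N sets of positions for `qs`, and the other entries are free. The product
form avoids a negative exponent when `qs` is longer than `N`. -/
theorem sum_sublist_ofFn_le (N : ℕ) (qs : List V) :
    (∑ u : Fin N → V, if qs.Sublist (List.ofFn u) then (1 : ℝ) else 0)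
      * (Fintype.card V : ℝ) ^ qs.length ≤ 2 ^ N * (Fintype.card V : ℝ) ^ N := by
  induction N generalizing qs with
  | zero =>
    cases qs with
    | nil => simp
    | cons q qs => simp
  | succ N ih =>
    rw [sum_ofFn_succ (F := fun l => if qs.Sublist l then (1 : ℝ) else 0)]
    cases qs with
    | nil =>
      simp only [List.nil_sublist, if_true, sum_const, card_univ, nsmul_eq_mul, List.length_nil,
        pow_zero, mul_one, Fintype.card_fun, Fintype.card_fin]
      push_cast
      rw [← pow_succ']
      exact le_mul_of_one_le_left (by positivity) (one_le_pow₀ (by norm_num : (1 : ℝ) ≤ 2))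
    | cons q qs =>
      have h1 : ∑ x, ∑ u : Fin N → V, (if (q :: qs).Sublist (x :: List.ofFn u)
          then (1 : ℝ) else 0)
          ≤ ∑ x : V, ∑ u : Fin N → V, ((if (q :: qs).Sublist (List.ofFn u) then (1 : ℝ) else 0)
            + if x = q then (if qs.Sublist (List.ofFn u) then (1 : ℝ) else 0) else 0) := by
        refine sum_le_sum fun x _ => sum_le_sum fun u _ => ?_
        have p1 : (0 : ℝ) ≤ if (q :: qs).Sublist (List.ofFn u) then 1 else 0 := by
          split_ifs <;> norm_num
        have p2 : (0 : ℝ) ≤ if x = q then (if qs.Sublist (List.ofFn u) then (1 : ℝ) else 0)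
          else 0 := by split_ifs <;> norm_num
        by_cases h : (q :: qs).Sublist (x :: List.ofFn u)
        · rw [if_pos h]
          cases h with
          | cons _ h => rw [if_pos h]; linarith
          | cons_cons _ h => rw [if_pos rfl, if_pos h]; linarith
        · rw [if_neg h]
          positivity
      have h2 : ∑ x : V, ∑ u : Fin N → V,
          ((if (q :: qs).Sublist (List.ofFn u) then (1 : ℝ) else 0)
            + if x = q then (if qs.Sublist (List.ofFn u) then (1 : ℝ) else 0) else 0)
          = Fintype.card V * (∑ u : Fin N → V,
              if (q :: qs).Sublist (List.ofFn u) then (1 : ℝ) else 0)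
            + ∑ u : Fin N → V, if qs.Sublist (List.ofFn u) then (1 : ℝ) else 0 := by
        simp only [sum_add_distrib]
        congr 1
        · rw [sum_const, card_univ, nsmul_eq_mul]
        · rw [sum_comm]
          exact sum_congr rfl fun u _ => by simp
      have i1 := ih (q :: qs)
      have i2 := ih qs
      have hc : (0 : ℝ) ≤ Fintype.card V := by positivity
      calc _ ≤ (Fintype.card V * (∑ u : Fin N → V,
              if (q :: qs).Sublist (List.ofFn u) then (1 : ℝ) else 0)
            + ∑ u : Fin N → V, if qs.Sublist (List.ofFn u) then (1 : ℝ) else 0)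
              * (Fintype.card V : ℝ) ^ (q :: qs).length := by
            gcongr
            exact h1.trans_eq h2
        _ = Fintype.card V * ((∑ u : Fin N → V,
              if (q :: qs).Sublist (List.ofFn u) then (1 : ℝ) else 0)
                * (Fintype.card V : ℝ) ^ (q :: qs).length)
            + Fintype.card V * ((∑ u : Fin N → V, if qs.Sublist (List.ofFn u)
              then (1 : ℝ) else 0) * (Fintype.card V : ℝ) ^ qs.length) := by
            rw [List.length_cons, pow_succ]; ring
        _ ≤ Fintype.card V * (2 ^ N * (Fintype.card V : ℝ) ^ N)
            + Fintype.card V * (2 ^ N * (Fintype.card V : ℝ) ^ N) := by gcongr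
        _ = _ := by rw [pow_succ, pow_succ]; ring

/-- All lists of length less than `M`. -/
def listsBelow (V : Type*) [Fintype V] [DecidableEq V] (M : ℕ) : Finset (List V) :=
  (range M).biUnion fun N => (univ : Finset (Fin N → V)).image List.ofFn

theorem mem_listsBelow {M : ℕ} {l : List V} : l ∈ listsBelow V M ↔ l.length < M := by
  simp only [listsBelow, mem_biUnion, mem_range, mem_image, mem_univ, true_and]
  constructor
  · rintro ⟨N, hN, u, rfl⟩
    simpa using hN
  · intro h
    exact ⟨l.length, h, l.get, List.ofFn_get l⟩

theorem sum_listsBelow (M : ℕ) (F : List V → ℝ) :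
    ∑ l ∈ listsBelow V M, F l = ∑ N ∈ range M, ∑ u : Fin N → V, F (List.ofFn u) := by
  rw [listsBelow, sum_biUnion]
  · refine sum_congr rfl fun N _ => ?_
    rw [sum_image fun u _ v _ h => List.ofFn_injective h]
  · intro N _ N' _ hne
    rw [Function.onFun, disjoint_left]
    intro l h h'
    simp only [mem_image, mem_univ, true_and] at h h'
    obtain ⟨u, rfl⟩ := h
    obtain ⟨v, hv⟩ := h'
    have := congrArg List.length hv
    simp only [List.length_ofFn] at this
    exact hne this.symm

end Lists

namespace NAESat

/-! ### Expected numbers of escaping variables and of pairs in balls -/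

section Counting

variable {n K m : ℕ}

/-- The growth rate of the number of trees of bounded width in the factor graph. -/
noncomputable def growthRate (K W : ℕ) (d : ℝ) : ℝ := 1 + 2 * (1 + d) * W * K

/-- A tree on N vertices has N - 1 edges, so the powers of `n` cancel except one. The 2 anticipates
the count of sublist positions. -/
theorem pow_mul_pow_le (hn : 0 < n) {d : ℝ} (hd : 0 ≤ d) (hm : (m : ℝ) ≤ d * n) (W : ℕ)
    {N M : ℕ} (hN : N ≤ M) : (2 * (n + m : ℝ)) ^ N * (W * K / n : ℝ) ^ (N - 1)
      ≤ 2 * (1 + d) * n * growthRate K W d ^ M := by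
  have hn' : (1 : ℝ) ≤ n := by exact_mod_cast hn
  have hg : 1 ≤ growthRate K W d := by
    unfold growthRate
    have : 0 ≤ 2 * (1 + d) * W * K := by positivity
    linarith
  have hV : (n + m : ℝ) ≤ (1 + d) * n := by linarith
  rcases N with _ | N
  · simp only [pow_zero, Nat.zero_sub, mul_one]
    have h1 : 1 ≤ 2 * (1 + d) * (n : ℝ) := by nlinarith
    exact one_le_mul_of_one_le_of_one_le h1 (one_le_pow₀ hg)
  · rw [Nat.add_sub_cancel, pow_succ]
    calc (2 * (n + m : ℝ)) ^ N * (2 * (n + m : ℝ)) * (W * K / n : ℝ) ^ N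
        = 2 * (n + m : ℝ) * (2 * (n + m : ℝ) * (W * K / n)) ^ N := by
          rw [mul_pow _ (W * K / n : ℝ)]; ring
      _ ≤ 2 * ((1 + d) * n) * (2 * ((1 + d) * n) * (W * K / n)) ^ N := by gcongr
      _ = 2 * (1 + d) * n * (2 * (1 + d) * W * K) ^ N := by
          have : 2 * ((1 + d) * n) * (W * K / n : ℝ) = 2 * (1 + d) * W * K := by field_simp
          rw [this]
          ring
      _ ≤ 2 * (1 + d) * n * growthRate K W d ^ M := by
          gcongr
          calc (2 * (1 + d) * W * K) ^ N ≤ growthRate K W d ^ N := by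
                gcongr
                unfold growthRate
                linarith
            _ ≤ growthRate K W d ^ M := pow_le_pow_right₀ hg (by omega)

/-- The decisions that influence that at `k` come from outside the ball of radius `T`. -/
def Escapes (r T : ℕ) (Φ : Formula n K m) (k : Fin n) : Prop :=
  ∃ e, Relation.ReflTransGen (DependsOn r Φ) k e ∧
    ¬ WithinDist (FactorAdj Φ) T (.inl k) (.inl e)

open Classical in
-- Each escaping `k` is the oldest vertex of its grown list, so different `k` have different lists.
-- The marked variables are sorted, hence determined by their set `B`; this is what later yields the
-- factorial.
theorem card_escapes_le (r L : ℕ) (Φ : Formula n K m) :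
    (#(univ.filter fun k => Escapes r (2 * (2 * r + 2) * L + 1 + (2 * r + 2)) Φ k) : ℝ)
      ≤ ∑ l ∈ listsBelow (Fin n ⊕ Fin m) (2 * (2 * r + 2) * L + 2),
        ∑ B ∈ powersetCard (L + 1) (univ : Finset (Fin n)),
          (if ((B.sort (· ≤ ·)).map Sum.inl).Sublist l then (1 : ℝ) else 0) *
            if Grown (FactorAdj Φ) (2 * (2 * r + 2)) l then 1 else 0 := by
  set R := 2 * r + 2 with hR
  obtain ⟨P, hP⟩ : ∃ P : List (Fin n ⊕ Fin m) → Prop, ∀ l, P l ↔ Grown (FactorAdj Φ) (2 * R) l ∧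
      ∃ B ∈ powersetCard (L + 1) (univ : Finset (Fin n)),
        ((B.sort (· ≤ ·)).map Sum.inl).Sublist l := ⟨_, fun _ => Iff.rfl⟩
  set 𝓛 := (listsBelow (Fin n ⊕ Fin m) (2 * R * L + 2)).filter P with h𝓛
  have hex : ∀ k, Escapes r (2 * R * L + 1 + R) Φ k → ∃ l ∈ 𝓛, l.getLast? = some (.inl k) := by
    rintro k ⟨e, hke, hfar⟩
    obtain ⟨l, ps, h1, h2, h3, h4, h5, h6⟩ := exists_grown_of_escape (FactorAdj.symm Φ)
      (Sum.inl : Fin n → Fin n ⊕ Fin m) (by omega : 0 < R) L hke hfar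
    refine ⟨l, ?_, h3⟩
    have hnd : ps.Nodup := h5.imp fun h => h.ne
    have hsort : ps.toFinset.sort (· ≤ ·) = ps :=
      (List.toFinset_sort _ hnd).2 (h5.imp fun h => h.le)
    rw [h𝓛, mem_filter, mem_listsBelow, hP]
    refine ⟨by omega, h1, ps.toFinset, ?_, by rwa [hsort]⟩
    rw [mem_powersetCard]
    exact ⟨subset_univ _, by rw [List.toFinset_card_of_nodup hnd, h4]⟩
  choose! g hg hlast using hex
  have hcard : #(univ.filter fun k => Escapes r (2 * R * L + 1 + R) Φ k) ≤ #𝓛 := by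
    refine card_le_card_of_injOn g (fun k hk => hg k (mem_filter.1 hk).2) ?_
    intro k hk k' hk' h
    have e1 := hlast k (mem_filter.1 hk).2
    have e2 := hlast k' (mem_filter.1 hk').2
    rw [h, e2] at e1
    simpa using e1.symm
  refine (Nat.cast_le.2 hcard).trans ?_
  rw [h𝓛, card_filter, Nat.cast_sum]
  refine sum_le_sum fun l _ => ?_
  rw [Nat.cast_ite, Nat.cast_one, Nat.cast_zero]
  have h0 : ∀ B : Finset (Fin n), (0 : ℝ) ≤
      (if ((B.sort (· ≤ ·)).map Sum.inl).Sublist l then (1 : ℝ) else 0) *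
        if Grown (FactorAdj Φ) (2 * R) l then 1 else 0 := fun B =>
    mul_nonneg (by split_ifs <;> norm_num) (by split_ifs <;> norm_num)
  by_cases h : P l
  · rw [if_pos h]
    obtain ⟨hgr, B, hB, hsub⟩ := (hP l).1 h
    refine le_trans ?_ (single_le_sum (fun B _ => h0 B) hB)
    rw [if_pos hsub, if_pos hgr, mul_one]
  · rw [if_neg h]
    exact sum_nonneg fun B _ => h0 B

open Classical in
theorem expect_escapes_le (hn : K ≤ n) (hn0 : 0 < n) {d : ℝ} (hd : 0 ≤ d)
    (hm : (m : ℝ) ≤ d * n) (r L : ℕ) :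
    𝔼 Φ : Formula n K m,
      (#(univ.filter fun k => Escapes r (2 * (2 * r + 2) * L + 1 + (2 * r + 2)) Φ k) : ℝ)
      ≤ (2 * (2 * r + 2) * L + 2) * (2 * (1 + d) * n *
        growthRate K (2 * (2 * r + 2)) d ^ (2 * (2 * r + 2) * L + 2)) / (L + 1).factorial := by
  set R := 2 * r + 2 with hR
  set M := 2 * R * L + 2 with hM
  set V : ℝ := n + m with hV
  have hVpos : 0 < V := by positivity
  have hVcard : (Fintype.card (Fin n ⊕ Fin m) : ℝ) = V := by simp [hV]
  set Q : ℝ := 2 * (1 + d) * n * growthRate K (2 * R) d ^ M with hQ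
  -- The gain from the fixed order of the variables: a set of marks in place of a sequence saves (L
  -- + 1)!.
  have hchoose : (n.choose (L + 1) : ℝ) ≤ V ^ (L + 1) / (L + 1).factorial := by
    refine (Nat.choose_le_pow_div (α := ℝ) (L + 1) n).trans ?_
    gcongr
    rw [hV]; linarith [(Nat.cast_nonneg m : (0 : ℝ) ≤ m)]
  calc _ ≤ 𝔼 Φ : Formula n K m, ∑ l ∈ listsBelow (Fin n ⊕ Fin m) M,
        ∑ B ∈ powersetCard (L + 1) (univ : Finset (Fin n)),
          (if ((B.sort (· ≤ ·)).map Sum.inl).Sublist l then (1 : ℝ) else 0) *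
            (if Grown (FactorAdj Φ) (2 * R) l then 1 else 0) :=
        expect_le_expect fun Φ _ => card_escapes_le r L Φ
    _ = ∑ l ∈ listsBelow (Fin n ⊕ Fin m) M, ∑ B ∈ powersetCard (L + 1) (univ : Finset (Fin n)),
          (if ((B.sort (· ≤ ·)).map Sum.inl).Sublist l then (1 : ℝ) else 0) *
            𝔼 Φ : Formula n K m, (if Grown (FactorAdj Φ) (2 * R) l then 1 else 0) := by
        rw [expect_sum_comm]
        refine sum_congr rfl fun l _ => ?_
        rw [expect_sum_comm]
        exact sum_congr rfl fun B _ => by rw [mul_expect]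
    _ ≤ ∑ l ∈ listsBelow (Fin n ⊕ Fin m) M, ∑ B ∈ powersetCard (L + 1) (univ : Finset (Fin n)),
          (if ((B.sort (· ≤ ·)).map Sum.inl).Sublist l then (1 : ℝ) else 0) *
            ((2 * R : ℕ) * K / n : ℝ) ^ (l.length - 1) := by
        refine sum_le_sum fun l _ => sum_le_sum fun B _ => ?_
        refine mul_le_mul_of_nonneg_left (expect_grown_le hn _ l) ?_
        split_ifs <;> norm_num
    _ = ∑ N ∈ range M, ∑ B ∈ powersetCard (L + 1) (univ : Finset (Fin n)),
          (∑ u : Fin N → Fin n ⊕ Fin m,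
            if ((B.sort (· ≤ ·)).map Sum.inl).Sublist (List.ofFn u) then (1 : ℝ) else 0) *
            ((2 * R : ℕ) * K / n : ℝ) ^ (N - 1) := by
        rw [sum_listsBelow]
        refine sum_congr rfl fun N _ => ?_
        rw [sum_comm]
        refine sum_congr rfl fun B _ => ?_
        simp only [List.length_ofFn, sum_mul]
    _ ≤ ∑ N ∈ range M, ∑ B ∈ powersetCard (L + 1) (univ : Finset (Fin n)),
          ((2 * V) ^ N / V ^ (L + 1)) * ((2 * R : ℕ) * K / n : ℝ) ^ (N - 1) := by
        refine sum_le_sum fun N _ => sum_le_sum fun B hB => ?_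
        refine mul_le_mul_of_nonneg_right ?_ (by positivity)
        rw [le_div_iff₀ (by positivity), mul_pow]
        have h := sum_sublist_ofFn_le N ((B.sort (· ≤ ·)).map (Sum.inl : Fin n → Fin n ⊕ Fin m))
        rw [hVcard, List.length_map, length_sort, (mem_powersetCard.1 hB).2] at h
        exact h
    _ = ∑ N ∈ range M, (n.choose (L + 1) / V ^ (L + 1)) *
          ((2 * V) ^ N * ((2 * R : ℕ) * K / n : ℝ) ^ (N - 1)) := by
        refine sum_congr rfl fun N _ => ?_
        rw [sum_const, card_powersetCard, card_univ, Fintype.card_fin, nsmul_eq_mul]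
        ring
    _ ≤ ∑ N ∈ range M, (1 / (L + 1).factorial) * Q := by
        refine sum_le_sum fun N hN => ?_
        refine mul_le_mul ?_ (pow_mul_pow_le hn0 hd hm _ (mem_range.1 hN).le) (by positivity)
          (by positivity)
        rw [div_le_iff₀ (by positivity)]
        refine hchoose.trans_eq ?_
        ring
    _ = _ := by
        rw [sum_const, card_range, nsmul_eq_mul, hM, hR]
        push_cast
        ring

open Classical in
-- The squares count triples (c, k, k') with both variables near `c`. Each triple lies in a grown
-- list, and a list contains at most the cube of its length many triples.
theorem sum_sq_card_ball_le (T : ℕ) (Φ : Formula n K m) :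
    ∑ c : Fin m,
      (#(univ.filter fun k : Fin n => WithinDist (FactorAdj Φ) T (.inl k) (.inr c)) : ℝ) ^ 2
      ≤ ∑ l ∈ listsBelow (Fin n ⊕ Fin m) (2 * T + 2),
        (l.length : ℝ) ^ 3 * if Grown (FactorAdj Φ) (T + 1) l then 1 else 0 := by
  let tri : Finset (Fin m × Fin n × Fin n) := univ.filter fun p =>
    WithinDist (FactorAdj Φ) T (.inl p.2.1) (.inr p.1) ∧
      WithinDist (FactorAdj Φ) T (.inl p.2.2) (.inr p.1)
  have h1 : ∑ c : Fin m,
      (#(univ.filter fun k : Fin n => WithinDist (FactorAdj Φ) T (.inl k) (.inr c))) ^ 2 = #tri := by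
    rw [card_eq_sum_card_fiberwise (f := Prod.fst) (t := univ) (fun _ _ => by simp)]
    refine sum_congr rfl fun c _ => ?_
    rw [sq, ← card_product]
    refine card_bij (fun p _ => (c, p.1, p.2)) ?_ ?_ ?_
    · rintro ⟨k, k'⟩ hp
      simpa [tri] using hp
    · rintro ⟨k, k'⟩ _ ⟨j, j'⟩ _ h
      simpa using h
    · rintro ⟨c', k, k'⟩ h
      simp only [tri, mem_filter, mem_univ, true_and] at h
      obtain ⟨h, rfl⟩ := h
      exact ⟨(k, k'), by simpa using h, rfl⟩
  let F : Fin m × Fin n × Fin n → (Fin n ⊕ Fin m) × (Fin n ⊕ Fin m) × (Fin n ⊕ Fin m) :=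
    fun p => (.inr p.1, .inl p.2.1, .inl p.2.2)
  have hF : Function.Injective F := by
    rintro ⟨c, k, k'⟩ ⟨c', j, j'⟩ h
    simpa [F] using h
  have h2 : tri.image F ⊆ ((listsBelow (Fin n ⊕ Fin m) (2 * T + 2)).filter fun l =>
      Grown (FactorAdj Φ) (T + 1) l).biUnion fun l =>
        l.toFinset ×ˢ (l.toFinset ×ˢ l.toFinset) := by
    intro p hp
    obtain ⟨⟨c, k, k'⟩, hmem, rfl⟩ := mem_image.1 hp
    obtain ⟨ha, hb⟩ := (mem_filter.1 hmem).2
    obtain ⟨l, hl, hlen, hk, hc, hk'⟩ := Grown.exists_of_withinDist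
      (ha.symm (FactorAdj.symm Φ)) hb
    rw [mem_biUnion]
    refine ⟨l, mem_filter.2 ⟨mem_listsBelow.2 (by omega), hl⟩, ?_⟩
    simp only [F, mem_product, List.mem_toFinset]
    exact ⟨hc, hk, hk'⟩
  have h3 : #tri ≤ ∑ l ∈ (listsBelow (Fin n ⊕ Fin m) (2 * T + 2)).filter fun l =>
      Grown (FactorAdj Φ) (T + 1) l, l.length ^ 3 := by
    rw [← card_image_of_injective tri hF]
    refine (card_le_card h2).trans (card_biUnion_le.trans (sum_le_sum fun l _ => ?_))
    rw [card_product, card_product]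
    calc _ ≤ l.length * (l.length * l.length) := by
          gcongr <;> exact List.toFinset_card_le l
      _ = l.length ^ 3 := by ring
  rw [sum_filter] at h3
  calc _ = ((#tri : ℕ) : ℝ) := by rw [← h1]; push_cast; rfl
    _ ≤ _ := Nat.cast_le.2 h3
    _ = _ := by
      push_cast
      refine sum_congr rfl fun l _ => ?_
      split_ifs <;> simp

open Classical in
theorem expect_sum_sq_card_ball_le (hn : K ≤ n) (hn0 : 0 < n) {d : ℝ} (hd : 0 ≤ d)
    (hm : (m : ℝ) ≤ d * n) (T : ℕ) :
    𝔼 Φ : Formula n K m, ∑ c : Fin m,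
      (#(univ.filter fun k : Fin n => WithinDist (FactorAdj Φ) T (.inl k) (.inr c)) : ℝ) ^ 2
      ≤ (2 * T + 2) ^ 4 * (2 * (1 + d) * growthRate K (T + 1) d ^ (2 * T + 2)) * n := by
  calc _ ≤ 𝔼 Φ : Formula n K m, ∑ l ∈ listsBelow (Fin n ⊕ Fin m) (2 * T + 2),
        (l.length : ℝ) ^ 3 * (if Grown (FactorAdj Φ) (T + 1) l then 1 else 0) :=
        expect_le_expect fun Φ _ => sum_sq_card_ball_le T Φ
    _ = ∑ l ∈ listsBelow (Fin n ⊕ Fin m) (2 * T + 2), (l.length : ℝ) ^ 3 *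
          𝔼 Φ : Formula n K m, (if Grown (FactorAdj Φ) (T + 1) l then 1 else 0) := by
        rw [expect_sum_comm]
        exact sum_congr rfl fun l _ => by rw [mul_expect]
    _ ≤ ∑ l ∈ listsBelow (Fin n ⊕ Fin m) (2 * T + 2), (l.length : ℝ) ^ 3 *
          ((T + 1 : ℕ) * K / n : ℝ) ^ (l.length - 1) := by
        refine sum_le_sum fun l _ => ?_
        exact mul_le_mul_of_nonneg_left (expect_grown_le hn _ l) (by positivity)
    _ = ∑ N ∈ range (2 * T + 2), (N : ℝ) ^ 3 *
          (((n + m : ℝ)) ^ N * ((T + 1 : ℕ) * K / n : ℝ) ^ (N - 1)) := by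
        rw [sum_listsBelow]
        refine sum_congr rfl fun N _ => ?_
        simp only [List.length_ofFn, sum_const, card_univ, Fintype.card_fun, Fintype.card_fin,
          Fintype.card_sum, nsmul_eq_mul]
        push_cast
        ring
    _ ≤ ∑ N ∈ range (2 * T + 2), (2 * T + 2 : ℝ) ^ 3 *
          (2 * (1 + d) * n * growthRate K (T + 1) d ^ (2 * T + 2)) := by
        refine sum_le_sum fun N hN => ?_
        have hN' := (mem_range.1 hN).le
        refine mul_le_mul ?_ ?_ (by positivity) (by positivity)
        · gcongr
          exact_mod_cast hN'
        · refine le_trans ?_ (pow_mul_pow_le (K := K) hn0 hd hm (T + 1) hN')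
          gcongr
          linarith [(by positivity : (0 : ℝ) ≤ n + m)]
    _ = _ := by
        rw [sum_const, card_range, nsmul_eq_mul]
        push_cast
        ring

end Counting

end NAESat

/-! ### Approximation of decimation by maps of bounded sensitivity -/

theorem expect_expect_update {α : Type*} [Fintype α] [Nonempty α] {m : ℕ} (c : Fin m)
    (h : (Fin m → α) → ℝ) : 𝔼 Φ, 𝔼 a, h (Function.update Φ c a) = 𝔼 Φ, h Φ := by
  let e : ((Fin m → α) × α) ≃ ((Fin m → α) × α) :=
    { toFun := fun p => (Function.update p.1 c p.2, p.1 c)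
      invFun := fun p => (Function.update p.1 c p.2, p.1 c)
      left_inv := fun p => by simp
      right_inv := fun p => by simp }
  calc 𝔼 Φ, 𝔼 a, h (Function.update Φ c a) = 𝔼 p : (Fin m → α) × α, h p.1 := by
        rw [← expect_product']
        exact Fintype.expect_equiv e _ _ fun p => rfl
    _ = 𝔼 Φ, 𝔼 _a : α, h Φ := by rw [← expect_product']; rfl
    _ = 𝔼 Φ, h Φ := expect_congr rfl fun Φ _ => Fintype.expect_const _

namespace NAESat

variable {n K m : ℕ}

open Classical in
-- Resampling clause `c` affects only variables that have `c` in their ball before or after. The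
-- resampled formula has the same law, so (a + b)² ≤ 2a² + 2b² gives the factor 4.
theorem sensitivity_localDecimation_le [Nonempty (Clause n K)] (r T : ℕ)
    (ω : Fin n → Seeds n m) :
    sensitivity (localDecimation (K := K) r T ω) ≤ 4 * 𝔼 Φ : Formula n K m, ∑ c : Fin m,
      (#(univ.filter fun k : Fin n => WithinDist (FactorAdj Φ) T (.inl k) (.inr c)) : ℝ) ^ 2 := by
  set D : Fin m → Formula n K m → ℝ := fun c Φ =>
    (#(univ.filter fun k : Fin n => WithinDist (FactorAdj Φ) T (.inl k) (.inr c)) : ℝ) with hD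
  have hdist : ∀ (c : Fin m) (Φ : Formula n K m) (C : Clause n K),
      (hammingDist (localDecimation r T ω Φ) (localDecimation r T ω (Function.update Φ c C)) : ℝ)
        ≤ D c Φ + D c (Function.update Φ c C) := by
    intro c Φ C
    rw [hD, ← Nat.cast_add, Nat.cast_le]
    refine le_trans (card_le_card ?_) (card_union_le _ _)
    intro k hk
    by_contra hnot
    simp only [mem_union, mem_filter, mem_univ, true_and, not_or] at hnot hk
    exact hk (localDecimation_update r T ω Φ c C k hnot.1 hnot.2)
  calc sensitivity (localDecimation (K := K) r T ω)
      ≤ ∑ c, 𝔼 Φ : Formula n K m, 𝔼 C : Clause n K,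
          (2 * D c Φ ^ 2 + 2 * D c (Function.update Φ c C) ^ 2) := by
        refine sum_le_sum fun c _ => expect_le_expect fun Φ _ => expect_le_expect fun C _ => ?_
        have h := hdist c Φ C
        have h0 : (0 : ℝ) ≤ hammingDist (localDecimation r T ω Φ)
          (localDecimation r T ω (Function.update Φ c C)) := Nat.cast_nonneg _
        nlinarith [sq_nonneg (D c Φ - D c (Function.update Φ c C))]
    _ = ∑ c, 4 * 𝔼 Φ : Formula n K m, D c Φ ^ 2 := by
        refine sum_congr rfl fun c _ => ?_
        have h1 := expect_expect_update c fun Φ : Formula n K m => 2 * D c Φ ^ 2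
        simp only [expect_add_distrib, Fintype.expect_const] at h1 ⊢
        rw [h1, ← mul_expect]
        ring
    _ = _ := by rw [← mul_sum, expect_sum_comm]

open Classical in
theorem hammingDist_spDecimation_le (r T : ℕ) (ω : Fin n → Seeds n m) (Φ : Formula n K m) :
    hammingDist (spDecimation r Φ ω) (localDecimation r (T + (2 * r + 1)) ω Φ)
      ≤ #(univ.filter fun k => Escapes r T Φ k) := by
  refine card_le_card fun k hk => ?_
  simp only [mem_filter, mem_univ, true_and] at hk ⊢
  by_contra hnot
  refine hk (spDecimation_eq_localDecimation r T ω Φ k fun j hj => ?_)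
  by_contra hfar
  exact hnot ⟨j, hj, hfar⟩

/-- Decimation is approximated by maps of bounded sensitivity, uniformly in the seeds. -/
theorem exists_local_approx (K r : ℕ) {d δ : ℝ} (hd : 0 ≤ d) (hδ : 0 < δ) :
    ∃ C : ℝ, 0 ≤ C ∧ ∀ n m : ℕ, K ≤ n → 0 < n → (m : ℝ) ≤ d * n → ∀ ω : Fin n → Seeds n m,
      ∃ B : Formula n K m → (Fin n → Bool), sensitivity B ≤ C * n ∧
        𝔼 Φ, (hammingDist (spDecimation r Φ ω) (B Φ) : ℝ) ≤ δ * n := by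
  classical
  set R := 2 * r + 2 with hR
  set Λ := growthRate K (2 * R) d with hΛ
  have hΛ0 : 0 ≤ Λ := by rw [hΛ, growthRate]; positivity
  -- The growth rate does not depend on `L`, so the factorial wins. `L`, and with it the radius and
  -- the constant `C`, is chosen independently of `n` and `m`.
  have hlim : Tendsto (fun L : ℕ => (2 * R * (2 * (1 + d) * Λ ^ 2)) *
      ((Λ ^ (2 * R)) ^ L / L.factorial)) atTop (𝓝 0) := by
    have := (FloorSemiring.tendsto_pow_div_factorial_atTop (Λ ^ (2 * R))).const_mul
      (2 * R * (2 * (1 + d) * Λ ^ 2))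
    simpa using this
  obtain ⟨L, hL⟩ := (hlim.eventually (gt_mem_nhds hδ)).exists
  set T := 2 * R * L + 1 + R with hT
  set T' := T + (2 * r + 1) with hT'
  have hg0 : 0 ≤ growthRate K (T' + 1) d := by rw [growthRate]; positivity
  refine ⟨4 * ((2 * T' + 2) ^ 4 * (2 * (1 + d) * growthRate K (T' + 1) d ^ (2 * T' + 2))),
    by positivity, fun n m hn hn0 hm ω => ⟨localDecimation r T' ω, ?_, ?_⟩⟩
  · have : Nonempty (Clause n K) := ⟨⟨Fin.castLEEmb hn, fun _ => true⟩⟩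
    refine (sensitivity_localDecimation_le r T' ω).trans ?_
    rw [mul_assoc]
    refine mul_le_mul_of_nonneg_left ?_ (by norm_num)
    exact expect_sum_sq_card_ball_le hn hn0 hd hm T'
  · calc _ ≤ 𝔼 Φ : Formula n K m, (#(univ.filter fun k => Escapes r T Φ k) : ℝ) :=
          expect_le_expect fun Φ _ => Nat.cast_le.2 (hammingDist_spDecimation_le r T ω Φ)
      _ ≤ (2 * R * L + 2) * (2 * (1 + d) * n * Λ ^ (2 * R * L + 2)) / (L + 1).factorial := by
          have := expect_escapes_le (m := m) hn hn0 hd hm r L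
          rw [hR]
          push_cast
          exact this
      -- Rounding up to a multiple of L + 1 cancels one factor of (L + 1)!.
      _ ≤ (2 * R * (L + 1)) * (2 * (1 + d) * n * Λ ^ (2 * R * L + 2)) / (L + 1).factorial := by
          have hR1 : (1 : ℝ) ≤ R := by exact_mod_cast (by omega : 1 ≤ R)
          gcongr
          linarith
      _ = ((2 * R * (2 * (1 + d) * Λ ^ 2)) * ((Λ ^ (2 * R)) ^ L / L.factorial)) * n := by
          rw [Nat.factorial_succ, pow_add, pow_mul]
          push_cast
          field_simp
      _ ≤ δ * n := by gcongr

end NAESat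

namespace NAESat

/-! ### Measurability in the seeds -/

section Measurability

variable {n K m : ℕ}

theorem measurable_seed (x : Fin n) (a : Fin m) (k : MessageKind) :
    Measurable fun q : Seeds n m => (q x a k : ℝ) := by fun_prop

/-- All messages are measurable functions of the seeds. -/
structure MeasurableMessages (Q : Seeds n m → Messages n m) : Prop where
  varU : ∀ x a, Measurable fun q => (Q q).varU x a
  varS : ∀ x a, Measurable fun q => (Q q).varS x a
  clS : ∀ a x, Measurable fun q => (Q q).clS a x
  clU : ∀ a x, Measurable fun q => (Q q).clU a x

theorem measurableMessages_initialMessages :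
    MeasurableMessages (initialMessages : Seeds n m → Messages n m) where
  varU x a := (measurable_seed x a _).div
    (((measurable_seed x a _).add (measurable_seed x a _)).add (measurable_seed x a _))
  varS x a := (measurable_seed x a _).div
    (((measurable_seed x a _).add (measurable_seed x a _)).add (measurable_seed x a _))
  clS a x := (measurable_seed x a _).div ((measurable_seed x a _).add (measurable_seed x a _))
  clU a x := (measurable_seed x a _).div ((measurable_seed x a _).add (measurable_seed x a _))

variable {Q : Seeds n m → Messages n m} (φ : ReducedFormula n m)

theorem MeasurableMessages.prod_clS (hQ : MeasurableMessages Q) (A : Finset (Fin m)) (x : Fin n) :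
    Measurable fun q => ∏ c ∈ A, (1 - (Q q).clS c x) :=
  Finset.measurable_fun_prod _ fun c _ => measurable_const.sub (hQ.clS c x)

theorem MeasurableMessages.prod_clU (hQ : MeasurableMessages Q) (A : Finset (Fin m)) (x : Fin n) :
    Measurable fun q => ∏ c ∈ A, (1 - (Q q).clU c x) :=
  Finset.measurable_fun_prod _ fun c _ => measurable_const.sub (hQ.clU c x)

theorem MeasurableMessages.prod_clStar (hQ : MeasurableMessages Q) (A : Finset (Fin m)) (x : Fin n) :
    Measurable fun q => ∏ c ∈ A, (1 - (Q q).clS c x - (Q q).clU c x) :=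
  Finset.measurable_fun_prod _ fun c _ => (measurable_const.sub (hQ.clS c x)).sub (hQ.clU c x)

theorem MeasurableMessages.nextMessages (hQ : MeasurableMessages Q) :
    MeasurableMessages fun q => nextMessages φ (Q q) := by
  have hStar : ∀ x a, Measurable fun q => nextRStar φ (Q q) x a := fun x a =>
    (hQ.prod_clStar _ x).mul (hQ.prod_clStar _ x)
  have hS : ∀ x a, Measurable fun q => nextRS φ (Q q) x a := fun x a =>
    ((hQ.prod_clS _ x).mul (hQ.prod_clU _ x)).sub (hStar x a)
  have hU : ∀ x a, Measurable fun q => nextRU φ (Q q) x a := fun x a =>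
    ((hQ.prod_clU _ x).mul (hQ.prod_clS _ x)).sub (hStar x a)
  refine ⟨fun x a => (hU x a).div (((hS x a).add (hU x a)).add (hStar x a)),
    fun x a => (hS x a).div (((hS x a).add (hU x a)).add (hStar x a)), fun a x => ?_,
    fun a x => ?_⟩
  · simp only [NAESat.nextMessages, nextClS]
    split
    · exact measurable_const
    · split_ifs
      · exact measurable_const
      · exact Finset.measurable_fun_prod _ fun l _ => hQ.varU l.1 a
  · simp only [NAESat.nextMessages, nextClU]
    split
    · exact measurable_const
    · split_ifs
      · exact measurable_const
      · exact Finset.measurable_fun_prod _ fun l _ => hQ.varS l.1 a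

theorem MeasurableMessages.measurableSet_lt (hQ : MeasurableMessages Q) (x : Fin n) :
    MeasurableSet {q | WZero φ (Q q) x < WOne φ (Q q) x} := by
  have hStar : Measurable fun q => rawWStar φ (Q q) x :=
    (hQ.prod_clStar _ x).mul (hQ.prod_clStar _ x)
  have h1 : Measurable fun q => rawWOne φ (Q q) x :=
    ((hQ.prod_clS _ x).mul (hQ.prod_clU _ x)).sub hStar
  have h0 : Measurable fun q => rawWZero φ (Q q) x :=
    ((hQ.prod_clS _ x).mul (hQ.prod_clU _ x)).sub hStar
  have hsum := (h1.add h0).add hStar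
  exact _root_.measurableSet_lt (h0.div hsum) (h1.div hsum)

theorem measurable_spDecision (r : ℕ) (x : Fin n) :
    Measurable fun q : Seeds n m => spDecision r φ q x := by
  have h : ∀ t, MeasurableMessages fun q : Seeds n m => messagesAt φ q t := by
    intro t
    induction t with
    | zero => exact measurableMessages_initialMessages
    | succ t ih => exact ih.nextMessages φ
  refine measurable_to_bool ?_
  convert (h r).measurableSet_lt φ x using 1
  ext q
  simp [spDecision]

instance : Countable (ReducedFormula n m) := by
  have h1 : Countable ClauseSign :=
    Function.Injective.countable
      (f := fun s : ClauseSign => (decide (s = .plus), decide (s = .minus)))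
      fun a b h => by cases a <;> cases b <;> simp_all
  have h2 : Countable (ReducedClause n) :=
    Function.Injective.countable (f := fun C : ReducedClause n => (C.lits, C.sign))
      fun ⟨_, _⟩ ⟨_, _⟩ h => by simpa using h
  infer_instance

/-- The formula on which messages are computed depends itself on earlier seeds. It takes countably
many values, and on each of them the next decision is a measurable function of fresh seeds. -/
theorem measurableSet_decimatedFormula (r : ℕ) (Φ : Formula n K m) (i : ℕ)
    (ψ : ReducedFormula n m) :
    MeasurableSet {ω : Fin n → Seeds n m | decimatedFormula r Φ ω i = ψ} := by
  induction i generalizing ψ with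
  | zero => exact MeasurableSet.const (Φ.toReduced = ψ)
  | succ i ih =>
    by_cases h : i < n
    · have : {ω : Fin n → Seeds n m | decimatedFormula r Φ ω (i + 1) = ψ} =
          ⋃ φ, {ω | decimatedFormula r Φ ω i = φ} ∩ (fun ω : Fin n → Seeds n m =>
            spDecision r φ (ω ⟨i, h⟩) ⟨i, h⟩) ⁻¹' {b | φ.assign ⟨i, h⟩ b = ψ} := by
        ext ω
        simp [decimatedFormula, h]
      rw [this]
      exact MeasurableSet.iUnion fun φ => (ih φ).inter
        (((measurable_spDecision φ r _).comp (measurable_pi_apply (⟨i, h⟩ : Fin n)))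
          (Set.toFinite {b | φ.assign ⟨i, h⟩ b = ψ}).measurableSet)
    · simpa only [decimatedFormula, h, dite_false] using ih ψ

theorem measurable_spDecimation (r : ℕ) (Φ : Formula n K m) :
    Measurable fun ω : Fin n → Seeds n m => spDecimation r Φ ω := by
  refine measurable_pi_iff.2 fun i => measurable_to_bool ?_
  have : (fun ω : Fin n → Seeds n m => spDecimation r Φ ω i) ⁻¹' {true} =
      ⋃ φ, {ω | decimatedFormula r Φ ω i = φ} ∩
        (fun ω : Fin n → Seeds n m => spDecision r φ (ω i) i) ⁻¹' {true} := by
    ext ω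
    simp [spDecimation]
  rw [this]
  exact MeasurableSet.iUnion fun φ => (measurableSet_decimatedFormula r Φ i φ).inter
    (((measurable_spDecision φ r i).comp (measurable_pi_apply i)) (measurableSet_singleton _))

theorem measurableSet_satisfies (r : ℕ) (Φ : Formula n K m) :
    MeasurableSet {ω : Fin n → Seeds n m | Φ.Satisfies (spDecimation r Φ ω)} :=
  measurable_spDecimation r Φ (t := {σ | Φ.Satisfies σ}) (Set.toFinite _).measurableSet

end Measurability

/-! ### Averaging over the seeds and conclusion -/

open Classical in
-- Exchanging the two averages allows the seeds to be fixed while the formula is random.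
theorem spSuccessProb_eq_integral (K n m r : ℕ) :
    spSuccessProb K n m r = ∫ ω : Fin n → Seeds n m, 𝔼 Φ : Formula n K m,
      if Φ.Satisfies (spDecimation r Φ ω) then (1 : ℝ) else 0 := by
  simp only [Fintype.expect_eq_sum_div_card]
  rw [integral_div, integral_finsetSum, spSuccessProb]
  · congr 1
    refine sum_congr rfl fun Φ _ => ?_
    rw [← integral_indicator_one (measurableSet_satisfies r Φ)]
    rfl
  · intro Φ _
    exact (integrable_const (1 : ℝ)).indicator (measurableSet_satisfies r Φ)

theorem spSuccessProb_nonneg (K n m r : ℕ) : 0 ≤ spSuccessProb K n m r :=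
  div_nonneg (sum_nonneg fun _ _ => measureReal_nonneg) (Nat.cast_nonneg _)

open Classical in
theorem spSuccessProb_le_of_forall {K n m r : ℕ} {ε : ℝ}
    (h : ∀ ω : Fin n → Seeds n m, 𝔼 Φ : Formula n K m,
      (if Φ.Satisfies (spDecimation r Φ ω) then (1 : ℝ) else 0) ≤ ε) :
    spSuccessProb K n m r ≤ ε := by
  rw [spSuccessProb_eq_integral]
  refine (integral_mono_of_nonneg (ae_of_all _ fun ω => ?_) (integrable_const ε)
    (ae_of_all _ h)).trans ?_
  · exact expect_nonneg fun Φ _ => by split_ifs <;> norm_num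
  · simp

/-- Above the threshold density, survey propagation guided decimation fails asymptotically almost
surely. -/
theorem tendsto_spSuccessProb {K : ℕ} (hK : 0 < K) (hK2 : 12 * (199 / 200 : ℝ) ^ K ≤ 1) {d : ℝ}
    (hd : (2 : ℝ) ^ K / 4 * Real.log 2 < d) (r : ℕ) :
    Tendsto (fun n : ℕ => spSuccessProb K n ⌊d * (n : ℝ)⌋₊ r) atTop (𝓝 0) := by
  classical
  have hd0 : 0 ≤ d := le_trans (by have := Real.log_pos one_lt_two; positivity) hd.le
  rw [Metric.tendsto_atTop]
  intro ε hε
  -- This δ makes the error term 7200 δ equal to half of (ε/2)³; the terms that vanish with `n` take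
  -- the other half.
  obtain ⟨C, hC0, hC⟩ := exists_local_approx K r (d := d) (δ := (ε / 2) ^ 3 / 14400) hd0
    (by positivity)
  have h1 : Tendsto (fun n : ℕ => Real.exp (5 / 2) * (2.283 * Real.exp (-(5 / 4 * Real.log 2))) ^ n
      + 12 * 2400 ^ 2 * C / n) atTop (𝓝 0) := by
    have ha := (tendsto_pow_atTop_nhds_zero_of_lt_one (by positivity) exp_mul_lt_one).const_mul
      (Real.exp (5 / 2))
    have hb := tendsto_const_div_atTop_nhds_zero_nat (12 * 2400 ^ 2 * C)
    simpa using ha.add hb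
  have h2 : ∀ᶠ n : ℕ in atTop, 2 * √(C * n) ≤ n / 800 := by
    filter_upwards [tendsto_natCast_atTop_atTop.eventually_ge_atTop (1600 ^ 2 * C)] with n hn
    have : √(C * n) ≤ n / 1600 := by
      rw [Real.sqrt_le_left (by positivity)]
      nlinarith [(Nat.cast_nonneg n : (0 : ℝ) ≤ n)]
    linarith
  obtain ⟨N, hN⟩ := eventually_atTop.1 ((h1.eventually (gt_mem_nhds
    (by positivity : 0 < (ε / 2) ^ 3 / 2))).and (h2.and ((eventually_ge_atTop K).and
      (eventually_gt_atTop 0))))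
  refine ⟨N, fun n hn => ?_⟩
  obtain ⟨hsmall, hsqrt, hKn, hn0⟩ := hN n hn
  rw [Real.dist_0_eq_abs, abs_of_nonneg (spSuccessProb_nonneg _ _ _ _)]
  refine lt_of_le_of_lt (spSuccessProb_le_of_forall fun ω => ?_) (half_lt_self hε)
  obtain ⟨B, hBs, hBd⟩ := hC n ⌊d * n⌋₊ hKn hn0 (Nat.floor_le (by positivity)) ω
  have hm : (2 : ℝ) ^ K / 4 * Real.log 2 * n ≤ (⌊d * n⌋₊ : ℝ) + 1 := by
    refine le_trans ?_ (Nat.lt_floor_add_one (d * n)).le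
    gcongr
  have h := success_pow_three_le_of_approx hK hK2 hKn hm (fun Φ => spDecimation r Φ ω) B hBs hBd
    hsqrt
  refine le_of_pow_le_pow_left₀ (by norm_num : 3 ≠ 0) (by positivity) (h.trans ?_)
  linarith

end NAESat

theorem mainTheorem4 :
    ∃ K₀ : ℕ, ∀ K : ℕ, K₀ ≤ K → ∀ d : ℝ, (2 : ℝ) ^ ((K : ℤ) - 2) * Real.log 2 < d →
      ∀ r : ℕ, 0 < r →
        Tendsto (fun n : ℕ => NAESat.spSuccessProb K n ⌊d * (n : ℝ)⌋₊ r) atTop (𝓝 0) := by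
  -- Besides positivity, the only condition on `K` is that double violations are rare enough.
  have h := ((tendsto_pow_atTop_nhds_zero_of_lt_one (by norm_num : (0 : ℝ) ≤ 199 / 200)
    (by norm_num)).const_mul 12).eventually (ge_mem_nhds (by norm_num : (12 : ℝ) * 0 < 1))
  obtain ⟨K₀, hK₀⟩ := eventually_atTop.1 (h.and (eventually_gt_atTop 0))
  refine ⟨K₀, fun K hK d hd r _ =>
    NAESat.tendsto_spSuccessProb (hK₀ K hK).2 (hK₀ K hK).1 ?_ r⟩
  rw [zpow_sub₀ two_ne_zero, zpow_natCast] at hd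
  norm_num at hd
  exact hd
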